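/- Let $\Gamma$ be a connected compact metric graph: finitely many vertices and edges, at least one edge, no loops and no multiple edges, each edge ${\bf e}$, with initial vertex $\mathrm i_{\bf e}$ and terminal vertex $\mathrm f_{\bf e}$, being identified with an interval $[0,\ell_{\bf e}]$ with $0<\ell_{\bf e}<\infty$. Let $\ell(A)$ denote the length of $A\subset\Gamma$, i.e. the sum over the edges of the Lebesgue measure of $A\cap{\bf e}$. A function $u$ on $\Gamma$ is a collection of functions $[u]_{\bf e}$ on $(0,\ell_{\bf e})$; the spaces $L^1(\Gamma)$, $L^\infty(\Gamma)$, $BV(\Gamma)$, $W^{1,2}(\Gamma)$ are defined edge by edge (no continuity at the vertices is required), $\int_\Gamma u=\sum_{\bf e}\int_0^{\ell_{\bf e}}[u]_{\bf e}$ and $\|u\|_1=\int_\Gamma|u|$. Let $X_K(\Gamma)$ be the set of ${\bf z}\in W^{1,2}(\Gamma)$ such that $\sum_{{\bf e}\ni{\bf v}}[{\bf z}]_{\bf e}({\bf v})=0$ for every vertex ${\bf v}$, where, for the continuous representative of ${\bf z}$ on each edge, $[{\bf z}]_{\bf e}({\bf v})=[{\bf z}]_{\bf e}(\ell_{\bf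 e})$ if ${\bf v}=\mathrm f_{\bf e}$ and $[{\bf z}]_{\bf e}({\bf v})=-[{\bf z}]_{\bf e}(0)$ if ${\bf v}=\mathrm i_{\bf e}$. For $u\in BV(\Gamma)$ put $$TV_\Gamma(u)=\sup\Big\{\Big|\int_\Gamma u\,{\bf z}'\Big| : {\bf z}\in X_K(\Gamma),\ \|{\bf z}\|_{L^\infty(\Gamma)}\le 1\Big\},$$ and put $TV_\Gamma(u)=+\infty$ for $u\in L^1(\Gamma)\setminus BV(\Gamma)$. For measurable $D\subset\Gamma$ let ${\rm Per}_\Gamma(D)=TV_\Gamma(\chi_D)$, and let $$h(\Gamma)=\inf\Big\{\frac{{\rm Per}_\Gamma(D)}{\min\{\ell(D),\ell(\Gamma\setminus D)\}} : D\subset\Gamma\text{ measurable},\ 0<\ell(D)<\ell(\Gamma)\Big\}$$ be the Cheeger constant of $\Gamma$. A real number $\mu$ is a median of $u$, written $\mu\in{\rm med}_\ell(u)$, if $\ell(\{u<\mu\})\le\frac12\ell(\Gamma)$ and $\ell(\{u>\mu\})\le\frac12\ell(\Gamma)$. Then $$h(\Gamma)=\min\Big\{\frac{TV_\Gamma(u)}{\|u-\mu\|_1}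 : u\in L^1(\Gamma)\text{ not a.e. constant},\ \mu\in{\rm med}_\ell(u)\Big\} =\inf\Big\{\sup_{c\in\mathbb R}\frac{TV_\Gamma(u)}{\|u-c\|_1} : u\in L^1(\Gamma)\text{ not a.e. constant}\Big\},$$ where the minimum is attained. -/

import Mathlib

open MeasureTheory Set
open scoped ENNReal ContDiff

/-- A connected compact metric graph with (finite) vertex set `V` and (finite) edge set `E`:
each edge is an ordered pair of distinct vertices (its initial and its terminal vertex) with a
finite positive length; there are no loops and no multiple edges, and the underlying
combinatorial graph is connected. -/
structure CompactMetricGraph (V E : Type*) [Fintype V] [Fintype E] where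
  src : E → V
  tgt : E → V
  len : E → ℝ
  len_pos : ∀ e, 0 < len e
  no_loops : ∀ e, src e ≠ tgt e
  no_multiple_edges : Function.Injective fun e => s(src e, tgt e)
  connected : (SimpleGraph.fromEdgeSet (Set.range fun e => s(src e, tgt e))).Connected

namespace CompactMetricGraph

variable {V E : Type*} [Fintype V] [Fintype E] (Γ : CompactMetricGraph V E)

/-- The points of the metric graph: its vertices and the interior points of its edges, the
latter given by the edge and the coordinate in `(0, ℓ_e)`. -/
inductive Point : Type _
  | vertex (v : V) : Point
  | inner (e : E) (t : ℝ) (ht : t ∈ Ioo 0 (Γ.len e)) : Point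

open Classical in
/-- The point of the edge `e` with coordinate `t ∈ [0, ℓ_e]` (for `t` outside this interval the
nearer end point is returned; such `t` are never used). -/
noncomputable def pt (e : E) (t : ℝ) : Γ.Point :=
  if h : t ∈ Ioo 0 (Γ.len e) then .inner e t h
  else if t ≤ 0 then .vertex (Γ.src e) else .vertex (Γ.tgt e)

/-- The set `c_e(A ∩ e) ⊆ [0, ℓ_e]` of the coordinates of the points of `A` on the edge `e`. -/
def coords (A : Set Γ.Point) (e : E) : Set ℝ :=
  {t | t ∈ Icc 0 (Γ.len e) ∧ Γ.pt e t ∈ A}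

/-- The length `ℓ(A)`: the sum over the edges of the Lebesgue measure of `c_e(A ∩ e)`. -/
noncomputable def length (A : Set Γ.Point) : ℝ≥0∞ :=
  ∑ e, volume (Γ.coords A e)

/-- (Lebesgue) measurable subsets of the graph. -/
def MeasSet (A : Set Γ.Point) : Prop :=
  ∀ e, NullMeasurableSet (Γ.coords A e) volume

/-- The restriction `[u]_e` of a function on the graph to an edge, in the coordinate of the edge.
Only its values on `(0, ℓ_e)` are used. -/
noncomputable def onEdge (u : Γ.Point → ℝ) (e : E) : ℝ → ℝ := fun t => u (Γ.pt e t)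

/-- `u ∈ L¹(Γ)`. -/
def MemL1 (u : Γ.Point → ℝ) : Prop :=
  ∀ e, IntegrableOn (Γ.onEdge u e) (Ioo 0 (Γ.len e)) volume

/-- The norm `‖u‖₁` of `L¹(Γ)`. -/
noncomputable def l1norm (u : Γ.Point → ℝ) : ℝ≥0∞ :=
  ∑ e, eLpNorm (Γ.onEdge u e) 1 (volume.restrict (Ioo 0 (Γ.len e)))

/-- `u` is almost everywhere equal to a constant. -/
def AEConst (u : Γ.Point → ℝ) : Prop :=
  ∃ c : ℝ, ∀ e, ∀ᵐ t ∂volume.restrict (Ioo 0 (Γ.len e)), Γ.onEdge u e t = c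

end CompactMetricGraph

/-- `φ` is a test function on the open interval `(a, b)`: `φ ∈ C_c^∞(a, b)`. -/
def IsTestFun (a b : ℝ) (φ : ℝ → ℝ) : Prop :=
  ContDiff ℝ ∞ φ ∧ HasCompactSupport φ ∧ tsupport φ ⊆ Ioo a b

/-- `f ∈ BV(a, b)`: `f ∈ L¹(a, b)` and its distributional derivative is a finite signed Radon
measure, written as the difference `p - n` of two finite positive Borel measures. (As test
functions vanish outside `(a, b)`, only the restrictions of `p` and `n` to `(a, b)` matter.) -/
def IsBVOn (a b : ℝ) (f : ℝ → ℝ) : Prop :=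
  IntegrableOn f (Ioo a b) volume ∧
  ∃ p n : Measure ℝ, IsFiniteMeasure p ∧ IsFiniteMeasure n ∧
    ∀ φ, IsTestFun a b φ →
      ∫ t in Ioo a b, f t * deriv φ t = -(∫ t, φ t ∂p - ∫ t, φ t ∂n)

/-- `z ∈ W^{1,2}(a, b)` with weak derivative `dz`, where `z` is the representative that is
continuous on `[a, b]`. -/
def IsW12On (a b : ℝ) (z dz : ℝ → ℝ) : Prop :=
  ContinuousOn z (Icc a b) ∧
  MemLp z 2 (volume.restrict (Ioo a b)) ∧ MemLp dz 2 (volume.restrict (Ioo a b)) ∧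
  ∀ φ, IsTestFun a b φ →
    ∫ t in Ioo a b, z t * deriv φ t = -∫ t in Ioo a b, dz t * φ t

namespace CompactMetricGraph

variable {V E : Type*} [Fintype V] [Fintype E] (Γ : CompactMetricGraph V E)

/-- `u ∈ BV(Γ)`: `[u]_e ∈ BV(0, ℓ_e)` on each edge; no continuity is asked at the vertices. -/
def MemBV (u : Γ.Point → ℝ) : Prop :=
  ∀ e, IsBVOn 0 (Γ.len e) (Γ.onEdge u e)

open Classical in
/-- The set `E_v` of the edges incident to `v`. -/
noncomputable def incident (v : V) : Finset E :=
  {e | Γ.src e = v ∨ Γ.tgt e = v}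

open Classical in
/-- The outgoing value `[z]_e(v)` at a vertex `v` of the edge `e`: it is `z_e(ℓ_e)` at the
terminal vertex of `e` and `-z_e(0)` at its initial vertex. -/
noncomputable def vertexValue (z : E → ℝ → ℝ) (e : E) (v : V) : ℝ :=
  if v = Γ.tgt e then z e (Γ.len e) else -z e 0

/-- `z ∈ X_K(Γ)` with weak derivative `dz`: `z` belongs to `W^{1,2}(Γ)` (that is, edge by edge) and
satisfies the Kirchhoff condition at every vertex. -/
def IsKirchhoffField (z dz : E → ℝ → ℝ) : Prop :=
  (∀ e, IsW12On 0 (Γ.len e) (z e) (dz e)) ∧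
  ∀ v, ∑ e ∈ Γ.incident v, Γ.vertexValue z e v = 0

/-- `‖z‖_{L^∞(Γ)} ≤ 1`. -/
def SupNormLeOne (z : E → ℝ → ℝ) : Prop :=
  ∀ e, ∀ᵐ t ∂volume.restrict (Ioo 0 (Γ.len e)), |z e t| ≤ 1

open Classical in
/-- The total variation `TV_Γ(u)`: for `u ∈ BV(Γ)` it is the supremum of `|∫_Γ u z'|` over all
`z ∈ X_K(Γ)` with `‖z‖_∞ ≤ 1`, and it is `∞` for `u ∉ BV(Γ)`. -/
noncomputable def TV (u : Γ.Point → ℝ) : ℝ≥0∞ :=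
  if Γ.MemBV u then
    ⨆ (z : E → ℝ → ℝ) (dz : E → ℝ → ℝ) (_ : Γ.IsKirchhoffField z dz) (_ : Γ.SupNormLeOne z),
      ENNReal.ofReal |∑ e, ∫ t in Ioo 0 (Γ.len e), Γ.onEdge u e t * dz e t|
  else ∞

/-- The `Γ`-perimeter of a set: the total variation of its characteristic function. -/
noncomputable def Per (D : Set Γ.Point) : ℝ≥0∞ :=
  Γ.TV (D.indicator fun _ => 1)

/-- The Cheeger constant `h(Γ)`. -/
noncomputable def cheeger : ℝ≥0∞ :=
  ⨅ (D : Set Γ.Point) (_ : Γ.MeasSet D) (_ : 0 < Γ.length D) (_ : Γ.length D < Γ.length univ),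
    Γ.Per D / min (Γ.length D) (Γ.length Dᶜ)

/-- `μ` is a median of `u` with respect to the length. -/
def IsMedian (u : Γ.Point → ℝ) (μ : ℝ) : Prop :=
  Γ.length {x | u x < μ} ≤ Γ.length univ / 2 ∧ Γ.length {x | μ < u x} ≤ Γ.length univ / 2

end CompactMetricGraph

/-!
Divide every edge into `n + 1` equal cells. For a `0`-`1` pattern on the cells let the combinatorial
perimeter be the number of jumps inside the edges plus, at each vertex, the smaller one of the
numbers of adjacent cells with value `1` and with value `0`. By the Kirchhoff condition, no
admissible field gives a pattern more than its combinatorial perimeter. Conversely, balancing the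
field at each vertex around a median of the adjacent values of a cell function gives a single field
which attains the perimeter for all superlevel sets of that function at once. Let `κ` be the infimum
of the isoperimetric quotients of patterns. Integrating over the levels yields
`κ ‖u - m‖₁ ≤ TV u` for cell functions with a median `m`, and by averaging over the cells for all
`u`.

Conversely, the perimeters in a minimizing sequence of patterns are bounded, so the number of jumps
on each edge is bounded, and by compactness the patterns converge to the characteristic function of
a set `D`. As the graph is connected, a nontrivial pattern has perimeter at least `1`, so neither
`D` nor its complement is null, and the isoperimetric quotient of `D` is at most `κ`. Hence `κ` is
the Cheeger constant, and the characteristic function of `D` is a minimizer.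
-/

section Median

open Filter Topology

/-- `m` is a median of the distribution `ν`. -/
def IsDistributionMedian (ν : Measure ℝ) (m : ℝ) : Prop :=
  ν (Iio m) ≤ ν univ / 2 ∧ ν (Ioi m) ≤ ν univ / 2

lemma measure_Iio_le_of_forall_lt {ν : Measure ℝ} {m : ℝ} {c : ℝ≥0∞}
    (h : ∀ t < m, ν (Iic t) ≤ c) : ν (Iio m) ≤ c := by
  obtain ⟨x, hx_mono, hx_lt, hx_lim⟩ := exists_seq_strictMono_tendsto m
  rw [← iUnion_Iic_eq_Iio_of_lt_of_tendsto hx_lt hx_lim,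
    Monotone.measure_iUnion fun _ _ h => Iic_subset_Iic.2 (hx_mono.monotone h)]
  exact iSup_le fun k => h _ (hx_lt k)

lemma measure_Ioi_le_of_forall_gt {ν : Measure ℝ} {m : ℝ} {c : ℝ≥0∞}
    (h : ∀ t > m, ν (Ici t) ≤ c) : ν (Ioi m) ≤ c := by
  obtain ⟨x, hx_anti, hx_gt, hx_lim⟩ := exists_seq_strictAnti_tendsto m
  rw [← iUnion_Ici_eq_Ioi_of_lt_of_tendsto hx_gt hx_lim,
    Monotone.measure_iUnion fun _ _ h => Ici_subset_Ici.2 (hx_anti.antitone h)]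
  exact iSup_le fun k => h _ (hx_gt k)

lemma measure_compl_le_half {α : Type*} [MeasurableSpace α] {ν : Measure α} [IsFiniteMeasure ν]
    {s : Set α} (hs : MeasurableSet s) (h : ν univ / 2 ≤ ν s) : ν sᶜ ≤ ν univ / 2 := by
  rw [measure_compl hs (measure_ne_top ν s), tsub_le_iff_right]
  calc ν univ = ν univ / 2 + ν univ / 2 := (ENNReal.add_halves _).symm
    _ ≤ ν univ / 2 + ν s := by gcongr

theorem exists_isDistributionMedian (ν : Measure ℝ) [IsFiniteMeasure ν] :
    ∃ m, IsDistributionMedian ν m := by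
  rcases eq_or_ne ν 0 with rfl | hν
  · exact ⟨0, by simp [IsDistributionMedian]⟩
  have hhalf : ν univ / 2 < ν univ :=
    ENNReal.half_lt_self (Measure.measure_univ_ne_zero.2 hν) (measure_ne_top ν univ)
  let T : Set ℝ := {t | ν univ / 2 ≤ ν (Iic t)}
  have hT_nonempty : T.Nonempty :=
    ((tendsto_measure_Iic_atTop ν).eventually_const_lt hhalf).exists.imp fun _ ht => ht.le
  obtain ⟨x, hx⟩ := ((tendsto_measure_Ici_atBot ν).eventually_const_lt hhalf).exists
  have hT_bddBelow : BddBelow T := by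
    refine ⟨x, fun t ht => ?_⟩
    by_contra! htx
    have hsub : Ici x ⊆ (Iic t)ᶜ := by rw [compl_Iic]; exact Ici_subset_Ioi.2 htx
    exact hx.not_ge ((measure_mono hsub).trans (measure_compl_le_half measurableSet_Iic ht))
  refine ⟨sInf T, measure_Iio_le_of_forall_lt fun t ht => ?_,
    measure_Ioi_le_of_forall_gt fun t ht => ?_⟩
  · have ht_notMem : t ∉ T := notMem_of_lt_csInf ht hT_bddBelow
    exact (not_le.1 ht_notMem).le
  · obtain ⟨r, hr, hrt⟩ := exists_lt_of_csInf_lt hT_nonempty ht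
    have hsub : Ici t ⊆ (Iic r)ᶜ := by rw [compl_Iic]; exact Ici_subset_Ioi.2 hrt
    exact (measure_mono hsub).trans (measure_compl_le_half measurableSet_Iic hr)

lemma lintegral_le_of_measure_le_half {α : Type*} [MeasurableSpace α] {ν : Measure α}
    [IsFiniteMeasure ν] {f g : α → ℝ≥0∞} (hf : Measurable f) (hg : Measurable g) {k : ℝ≥0∞}
    (hk : k ≠ ⊤) {s : Set α} (hs : MeasurableSet s) (hhalf : ν s ≤ ν univ / 2)
    (hcompl : ∀ x ∉ s, f x + k ≤ g x) (hle : ∀ x, f x ≤ g x + k) :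
    ∫⁻ x, f x ∂ν ≤ ∫⁻ x, g x ∂ν := by
  have hs_le : ν s ≤ ν sᶜ := by
    rw [measure_compl hs (measure_ne_top ν s)]
    refine ENNReal.le_sub_of_add_le_left (measure_ne_top ν s) ?_
    calc ν s + ν s ≤ ν univ / 2 + ν univ / 2 := by gcongr
      _ = ν univ := ENNReal.add_halves _
  refine (ENNReal.add_le_add_iff_right (ENNReal.mul_ne_top hk (measure_ne_top ν s))).1 ?_
  calc ∫⁻ x, f x ∂ν + k * ν s ≤ ∫⁻ x, f x ∂ν + k * ν sᶜ := by gcongr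
    _ = ∫⁻ x, f x + sᶜ.indicator (fun _ => k) x ∂ν := by
      rw [lintegral_add_left hf, lintegral_indicator_const hs.compl]
    _ ≤ ∫⁻ x, g x + s.indicator (fun _ => k) x ∂ν := by
      refine lintegral_mono fun x => ?_
      by_cases hx : x ∈ s
      · simpa [hx] using hle x
      · simpa [hx] using hcompl x hx
    _ = ∫⁻ x, g x ∂ν + k * ν s := by
      rw [lintegral_add_left hg, lintegral_indicator_const hs]

theorem IsDistributionMedian.lintegral_edist_le {ν : Measure ℝ} [IsFiniteMeasure ν] {m : ℝ}
    (hm : IsDistributionMedian ν m) (c : ℝ) : ∫⁻ x, edist x m ∂ν ≤ ∫⁻ x, edist x c ∂ν := by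
  have hmeas (r : ℝ) : Measurable fun x : ℝ => edist x r := by fun_prop
  have htri (x : ℝ) : edist x m ≤ edist x c + edist m c :=
    (edist_triangle x c m).trans_eq (by rw [edist_comm c m])
  have hbetween {x : ℝ} (h : |x - m| + |m - c| = |x - c|) : edist x m + edist m c ≤ edist x c := by
    rw [edist_dist, edist_dist, edist_dist, ← ENNReal.ofReal_add dist_nonneg dist_nonneg,
      Real.dist_eq, Real.dist_eq, Real.dist_eq, h]
  rcases le_total c m with hcm | hmc
  · refine lintegral_le_of_measure_le_half (hmeas m) (hmeas c) (edist_ne_top m c)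
      measurableSet_Iio hm.1 (fun x hx => hbetween ?_) htri
    have hmx : m ≤ x := not_lt.1 hx
    rw [abs_of_nonneg (sub_nonneg.2 hmx), abs_of_nonneg (sub_nonneg.2 hcm),
      abs_of_nonneg (sub_nonneg.2 (hcm.trans hmx))]
    ring
  · refine lintegral_le_of_measure_le_half (hmeas m) (hmeas c) (edist_ne_top m c)
      measurableSet_Ioi hm.2 (fun x hx => hbetween ?_) htri
    have hxm : x ≤ m := not_lt.1 hx
    rw [abs_of_nonpos (sub_nonpos.2 hxm), abs_of_nonpos (sub_nonpos.2 hmc),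
      abs_of_nonpos (sub_nonpos.2 (hxm.trans hmc))]
    ring

lemma exists_weighted_median {ι : Type*} (S : Finset ι) (a : ι → ℝ) {w : ι → ℝ}
    (hw : ∀ i ∈ S, 0 ≤ w i) :
    ∃ m : ℝ, 2 * ∑ i ∈ S with m < a i, w i ≤ ∑ i ∈ S, w i ∧
      2 * ∑ i ∈ S with a i < m, w i ≤ ∑ i ∈ S, w i := by
  classical
  let ν : Measure ℝ := ∑ i ∈ S, ENNReal.ofReal (w i) • Measure.dirac (a i)
  have hν (s : Set ℝ) (hs : MeasurableSet s) :
      ν s = ENNReal.ofReal (∑ i ∈ S with a i ∈ s, w i) := by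
    rw [ENNReal.ofReal_sum_of_nonneg fun i hi => hw i (Finset.mem_of_mem_filter i hi),
      Finset.sum_filter, Measure.finsetSum_apply]
    refine Finset.sum_congr rfl fun i _ => ?_
    by_cases hi : a i ∈ s <;> simp [Measure.dirac_apply' _ hs, hi]
  have hν_univ : ν univ = ENNReal.ofReal (∑ i ∈ S, w i) := by simpa using hν univ .univ
  have : IsFiniteMeasure ν := ⟨by rw [hν_univ]; exact ENNReal.ofReal_lt_top⟩
  have hreal {s : Set ℝ} (hs : MeasurableSet s) (h : ν s ≤ ν univ / 2) :
      2 * ∑ i ∈ S with a i ∈ s, w i ≤ ∑ i ∈ S, w i := by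
    rw [hν s hs, hν_univ, ← ENNReal.ofReal_ofNat 2, ← ENNReal.ofReal_div_of_pos two_pos,
      ENNReal.ofReal_le_ofReal_iff (by have := Finset.sum_nonneg hw; positivity)] at h
    linarith
  obtain ⟨m, hm⟩ := exists_isDistributionMedian ν
  exact ⟨m, hreal measurableSet_Ioi hm.2, hreal measurableSet_Iio hm.1⟩

end Median

section FiniteSums

variable {ι : Type*}

lemma sum_mul_nonneg_of_superlevel {S : Finset ι} {b q : ι → ℝ} (hb : ∀ i ∈ S, 0 ≤ b i)
    (h : ∀ t : ℝ, 0 < t → 0 ≤ ∑ i ∈ S with t < b i, q i) : 0 ≤ ∑ i ∈ S, b i * q i := by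
  have hlayer (i : ι) (hi : i ∈ S) :
      ∫ t in Ioi (0 : ℝ), (Iio (b i)).indicator (fun _ => q i) t = b i * q i := by
    rw [setIntegral_indicator measurableSet_Iio, setIntegral_const, Ioi_inter_Iio,
      Real.volume_real_Ioo_of_le (hb i hi), sub_zero, smul_eq_mul]
  have hint (i : ι) :
      IntegrableOn ((Iio (b i)).indicator fun _ => q i) (Ioi (0 : ℝ)) volume := by
    rw [IntegrableOn, integrable_indicator_iff measurableSet_Iio, IntegrableOn,
      Measure.restrict_restrict measurableSet_Iio, inter_comm, Ioi_inter_Iio]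
    exact integrableOn_const measure_Ioo_lt_top.ne
  rw [← Finset.sum_congr rfl hlayer, ← integral_finsetSum _ fun i _ => hint i]
  refine setIntegral_nonneg measurableSet_Ioi fun t ht => ?_
  simpa only [indicator_apply, mem_Iio, ← Finset.sum_filter] using h t ht

-- The median `m` makes `{A > t}`, for `t > m`, and `{A < t}`, for `t < m`, the smaller side.
theorem exists_mul_sum_abs_sub_le {S : Finset ι} {A q w : ι → ℝ} {κ : ℝ}
    (hq : ∀ i ∈ S, 0 ≤ q i) (hw : ∑ i ∈ S, w i = 0)
    (hlevel : ∀ (P : ℝ → Prop) [DecidablePred P], Monotone P →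
      κ * min (∑ i ∈ S with P (A i), q i) (∑ i ∈ S with ¬ P (A i), q i) ≤
        ∑ i ∈ S with P (A i), w i) :
    ∃ m : ℝ, κ * ∑ i ∈ S, |A i - m| * q i ≤ ∑ i ∈ S, A i * w i := by
  classical
  obtain ⟨m, habove, hbelow⟩ := exists_weighted_median S A hq
  have hsplit (P : ℝ → Prop) [DecidablePred P] (f : ι → ℝ) :=
    Finset.sum_filter_add_sum_filter_not S (fun i => P (A i)) f
  have hmono {P Q : ℝ → Prop} [DecidablePred P] [DecidablePred Q] (h : ∀ x, P x → Q x) :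
      ∑ i ∈ S with P (A i), q i ≤ ∑ i ∈ S with Q (A i), q i :=
    Finset.sum_le_sum_of_subset_of_nonneg
      (Finset.monotone_filter_right S fun i _ => h (A i))
      fun i hi _ => hq i (Finset.mem_of_mem_filter i hi)
  have hpos : 0 ≤ ∑ i ∈ S, (A i - m)⁺ * (w i - κ * q i) := by
    refine sum_mul_nonneg_of_superlevel (fun i _ => posPart_nonneg _) fun t ht => ?_
    have hset (i : ι) : t < (A i - m)⁺ ↔ m + t < A i := by
      rw [posPart_def, lt_sup_iff, lt_sub_iff_add_lt', or_iff_left ht.not_gt]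
    have hsmall := hmono (P := (m + t < ·)) (Q := (m < ·)) fun x hx => by linarith
    have hlev := hlevel (m + t < ·) fun x y hxy hx => hx.trans_le hxy
    rw [min_eq_left (by linarith [hsplit (m + t < ·) q])] at hlev
    simpa only [hset, Finset.sum_sub_distrib, ← Finset.mul_sum, sub_nonneg] using hlev
  have hneg : 0 ≤ ∑ i ∈ S, (A i - m)⁻ * (-w i - κ * q i) := by
    refine sum_mul_nonneg_of_superlevel (fun i _ => negPart_nonneg _) fun t ht => ?_
    have hset (i : ι) : t < (A i - m)⁻ ↔ ¬ m - t ≤ A i := by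
      rw [negPart_def, lt_sup_iff, neg_sub, not_le, lt_sub_comm, or_iff_left ht.not_gt]
    have hsmall := hmono (P := (¬ m - t ≤ ·)) (Q := (· < m)) fun x hx => by linarith
    have hlev := hlevel (m - t ≤ ·) fun x y hxy hx => hx.trans hxy
    rw [min_eq_right (by linarith [hsplit (m - t ≤ ·) q])] at hlev
    simp only [hset, Finset.sum_sub_distrib, ← Finset.mul_sum, Finset.sum_neg_distrib]
    linarith [hsplit (m - t ≤ ·) w]
  have hsum : ∑ i ∈ S, (A i - m)⁺ * (w i - κ * q i) + ∑ i ∈ S, (A i - m)⁻ * (-w i - κ * q i) =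
      ∑ i ∈ S, A i * w i - m * ∑ i ∈ S, w i - κ * ∑ i ∈ S, |A i - m| * q i := by
    simp only [Finset.mul_sum, ← Finset.sum_add_distrib, ← Finset.sum_sub_distrib]
    refine Finset.sum_congr rfl fun i _ => ?_
    linear_combination w i * posPart_sub_negPart (A i - m) -
      κ * q i * posPart_add_negPart (A i - m)
  exact ⟨m, by linarith [hw ▸ hsum]⟩

/-- A `0`-`1` valued function: the characteristic function of a set, as a real function. -/
def IsZeroOne (b : ι → ℝ) : Prop :=
  ∀ i, b i = 0 ∨ b i = 1

lemma IsZeroOne.mem_Icc {b : ι → ℝ} (hb : IsZeroOne b) (i : ι) : b i ∈ Icc 0 1 := by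
  rcases hb i with h | h <;> simp [h]

lemma IsZeroOne.eq_of_abs_sub_lt_one {b : ι → ℝ} (hb : IsZeroOne b) {i j : ι}
    (h : |b i - b j| < 1) : b i = b j := by
  rcases hb i with hi | hi <;> rcases hb j with hj | hj <;> simp_all

lemma IsZeroOne.eq_of_min_sum_lt_one {S : Finset ι} {b : ι → ℝ} (hb : IsZeroOne b)
    (h : min (∑ i ∈ S, b i) (∑ i ∈ S, (1 - b i)) < 1) {i j : ι} (hi : i ∈ S) (hj : j ∈ S) :
    b i = b j := by
  have hterm (k : ι) (hk : k ∈ S) : b k ≤ ∑ l ∈ S, b l :=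
    Finset.single_le_sum (fun l _ => (hb.mem_Icc l).1) hk
  have hterm' (k : ι) (hk : k ∈ S) : 1 - b k ≤ ∑ l ∈ S, (1 - b l) :=
    Finset.single_le_sum (f := fun l => 1 - b l) (fun l _ => sub_nonneg.2 (hb.mem_Icc l).2) hk
  rcases min_lt_iff.1 h with h | h
  · rw [(hb i).resolve_right ((hterm i hi).trans_lt h).ne,
      (hb j).resolve_right ((hterm j hj).trans_lt h).ne]
  · rw [(hb i).resolve_left fun h0 => by linarith [hterm' i hi],
      (hb j).resolve_left fun h0 => by linarith [hterm' j hj]]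

lemma sum_mul_le_min_sum {S : Finset ι} {b x : ι → ℝ} (hb : ∀ i, b i ∈ Icc 0 1)
    (hx : ∀ i ∈ S, |x i| ≤ 1) (hsum : ∑ i ∈ S, x i = 0) :
    ∑ i ∈ S, b i * x i ≤ min (∑ i ∈ S, b i) (∑ i ∈ S, (1 - b i)) := by
  have hcompl : ∑ i ∈ S, b i * x i = ∑ i ∈ S, (1 - b i) * -x i := by
    rw [← sub_eq_zero, ← Finset.sum_sub_distrib, ← hsum]
    exact Finset.sum_congr rfl fun _ _ => by ring
  refine le_min (Finset.sum_le_sum fun i hi => ?_) (hcompl ▸ Finset.sum_le_sum fun i hi => ?_)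
  · exact mul_le_of_le_one_right (hb i).1 (le_of_abs_le (hx i hi))
  · exact mul_le_of_le_one_right (sub_nonneg.2 (hb i).2) (neg_le_of_abs_le (hx i hi) |> neg_le.1)

/-- The signs `x` balance the family `a` about the level `m` on `S`: they add up to zero, and `x`
is `1` above and `-1` below `m`. -/
structure IsBalancedSign (S : Finset ι) (a x : ι → ℝ) (m : ℝ) : Prop where
  abs_le_one : ∀ i, |x i| ≤ 1
  sum_eq_zero : ∑ i ∈ S, x i = 0
  eq_one : ∀ i, m < a i → x i = 1
  eq_neg_one : ∀ i, a i < m → x i = -1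

theorem exists_isBalancedSign (S : Finset ι) (a : ι → ℝ) : ∃ x m, IsBalancedSign S a x m := by
  obtain ⟨m, habove, hbelow⟩ := exists_weighted_median S a fun _ _ => zero_le_one
  set P := ∑ i ∈ S with m < a i, (1 : ℝ)
  set Q := ∑ i ∈ S with a i < m, (1 : ℝ)
  set R := ∑ i ∈ S with a i = m, (1 : ℝ)
  have hPQR : P + Q + R = ∑ _i ∈ S, (1 : ℝ) := by
    simp only [P, Q, R, Finset.sum_filter, ← Finset.sum_add_distrib]
    exact Finset.sum_congr rfl fun _ _ => by grind
  have hR : 0 ≤ R := Finset.sum_nonneg fun _ _ => zero_le_one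
  let θ := (Q - P) / R
  have hθ : |θ| ≤ 1 := by
    rw [abs_div, abs_of_nonneg hR]
    exact div_le_one_of_le₀ (abs_le.2 ⟨by linarith, by linarith⟩) hR
  have hθR : θ * R = Q - P := div_mul_cancel_of_imp fun h => by linarith
  refine ⟨fun i => if m < a i then 1 else if a i < m then -1 else θ, m, fun _ => ?_, ?_,
    fun i hi => if_pos hi, fun i hi => by simp [hi, hi.not_gt]⟩
  · split_ifs <;> simp [hθ]
  calc _ = P - Q + θ * R := by
        simp only [P, Q, R, Finset.mul_sum, Finset.sum_filter, ← Finset.sum_add_distrib,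
          ← Finset.sum_sub_distrib]
        exact Finset.sum_congr rfl fun i _ => by grind
    _ = 0 := by rw [hθR]; ring

theorem IsBalancedSign.min_sum_le {S : Finset ι} {a x b : ι → ℝ} {m : ℝ}
    (hx : IsBalancedSign S a x m) (hb : IsZeroOne b)
    (hmono : ∀ i ∈ S, ∀ j ∈ S, a i ≤ a j → b i ≤ b j) :
    min (∑ i ∈ S, b i) (∑ i ∈ S, (1 - b i)) ≤ ∑ i ∈ S, b i * x i := by
  by_cases hlow : ∃ i ∈ S, b i = 1 ∧ a i ≤ m
  · obtain ⟨i, hi, hbi, hai⟩ := hlow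
    have hcompl : ∑ j ∈ S, b j * x j = ∑ j ∈ S, (1 - b j) * -x j := by
      rw [← sub_eq_zero, ← Finset.sum_sub_distrib, ← hx.sum_eq_zero]
      exact Finset.sum_congr rfl fun _ _ => by ring
    refine (min_le_right _ _).trans (hcompl ▸ (Finset.sum_congr rfl fun j hj => ?_).le)
    rcases hb j with h | h
    · have hlt : a j < m := by
        by_contra! hge
        linarith [hmono i hi j hj (hai.trans hge)]
      simp [h, hx.eq_neg_one j hlt]
    · simp [h]
  · push Not at hlow
    refine (min_le_left _ _).trans (Finset.sum_congr rfl fun j hj => ?_).le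
    rcases hb j with h | h
    · simp [h]
    · simp [h, hx.eq_one j (hlow j hj h)]

lemma sub_mul_sign_sub {x y a a' : ℝ} (h : a ≤ a' → x ≤ y) (h' : a' ≤ a → y ≤ x) :
    (x - y) * SignType.sign (a - a') = |x - y| := by
  rcases lt_trichotomy a a' with hlt | heq | hgt
  · rw [sign_neg (sub_neg.2 hlt), abs_of_nonpos (sub_nonpos.2 (h hlt.le))]
    simp
  · simp [le_antisymm (h heq.le) (h' heq.ge)]
  · rw [sign_pos (sub_pos.2 hgt), abs_of_nonneg (sub_nonneg.2 (h' hgt.le))]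
    simp

lemma sum_range_mul_sub (n : ℕ) (b η : ℕ → ℝ) :
    ∑ i ∈ Finset.range (n + 1), b i * (η (i + 1) - η i) =
      ∑ k ∈ Finset.range n, (b k - b (k + 1)) * η (k + 1) + (b n * η (n + 1) - b 0 * η 0) := by
  induction n with
  | zero => simp; ring
  | succ n ih => rw [Finset.sum_range_succ, ih, Finset.sum_range_succ _ n]; ring

end FiniteSums

namespace CompactMetricGraph

variable {V E : Type*} [Fintype V] [Fintype E] (Γ : CompactMetricGraph V E)

section Incidence

lemma mem_incident {v : V} {e : E} : e ∈ Γ.incident v ↔ Γ.src e = v ∨ Γ.tgt e = v := by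
  simp [incident]

lemma sum_incident (F : E → V → ℝ) :
    ∑ v, ∑ e ∈ Γ.incident v, F e v = ∑ e, (F e (Γ.tgt e) + F e (Γ.src e)) := by
  classical
  have hsplit (e : E) (v : V) : (if Γ.src e = v ∨ Γ.tgt e = v then F e v else 0) =
      (if Γ.tgt e = v then F e v else 0) + (if Γ.src e = v then F e v else 0) := by
    have := Γ.no_loops e
    grind
  simp only [incident, Finset.sum_filter, hsplit]
  rw [Finset.sum_comm]
  simp [Finset.sum_add_distrib]

theorem eq_of_forall_incident {α : Type*} {f : E → α}
    (h : ∀ v, ∀ e ∈ Γ.incident v, ∀ e' ∈ Γ.incident v, f e = f e') (e e' : E) : f e = f e' := by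
  have hwalk {v w : V}
      (walk : (SimpleGraph.fromEdgeSet (range fun e => s(Γ.src e, Γ.tgt e))).Walk v w) :
      ∀ e ∈ Γ.incident v, ∀ e' ∈ Γ.incident w, f e = f e' := by
    induction walk with
    | nil => exact h _
    | @cons u v w hadj _ ih =>
      intro e he e' he'
      obtain ⟨⟨g, hg⟩, -⟩ := (SimpleGraph.fromEdgeSet_adj _).1 hadj
      have hg_inc : g ∈ Γ.incident u ∧ g ∈ Γ.incident v := by
        simp only [mem_incident]
        rcases Sym2.eq_iff.1 hg with ⟨h₁, h₂⟩ | ⟨h₁, h₂⟩ <;> simp [h₁, h₂]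
      exact (h u e he g hg_inc.1).trans (ih g hg_inc.2 e' he')
  obtain ⟨p⟩ := Γ.connected.preconnected (Γ.src e) (Γ.src e')
  exact hwalk p e (Γ.mem_incident.2 (.inl rfl)) e' (Γ.mem_incident.2 (.inl rfl))

end Incidence

section Cells

open Classical in
/-- Each edge carries `n + 1` cells, numbered `0, …, n`; this is the value of the cell function `b`
on the cell of the edge `e` next to its end point `v`. -/
noncomputable def cellTrace (n : ℕ) (b : E → ℕ → ℝ) (e : E) (v : V) : ℝ :=
  if v = Γ.tgt e then b e n else b e 0

open Classical in
/-- The outgoing value at `v` of a field given at the `n + 2` nodes `0, …, n + 1` of the edge `e`;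
the discrete version of `vertexValue`. -/
noncomputable def nodeValue (n : ℕ) (η : E → ℕ → ℝ) (e : E) (v : V) : ℝ :=
  if v = Γ.tgt e then η e (n + 1) else -η e 0

/-- A field on the nodes that is bounded by one and satisfies the Kirchhoff condition; the discrete
version of an admissible competitor in the definition of `TV`. -/
structure IsNodalField (n : ℕ) (η : E → ℕ → ℝ) : Prop where
  abs_le_one : ∀ e i, |η e i| ≤ 1
  kirchhoff : ∀ v, ∑ e ∈ Γ.incident v, Γ.nodeValue n η e v = 0

/-- The discrete version of `∫_Γ b η'`, for a cell function `b` and a nodal field `η`. -/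
def cellPairing (n : ℕ) (b η : E → ℕ → ℝ) : ℝ :=
  ∑ e, ∑ i ∈ Finset.range (n + 1), b e i * (η e (i + 1) - η e i)

/-- The contribution of the vertex `v` to the perimeter of a `0`-`1` pattern `b`: the smaller one of
the numbers of cells at `v` with value `1` and with value `0`. -/
noncomputable def vertexCut (n : ℕ) (b : E → ℕ → ℝ) (v : V) : ℝ :=
  min (∑ e ∈ Γ.incident v, Γ.cellTrace n b e v) (∑ e ∈ Γ.incident v, (1 - Γ.cellTrace n b e v))

/-- The combinatorial perimeter of a `0`-`1` pattern `b` on the cells. -/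
noncomputable def cut (n : ℕ) (b : E → ℕ → ℝ) : ℝ :=
  ∑ e, ∑ k ∈ Finset.range n, |b e k - b e (k + 1)| + ∑ v, Γ.vertexCut n b v

variable {Γ} {n : ℕ} {b η : E → ℕ → ℝ}

lemma isZeroOne_cellTrace (hb : ∀ e, IsZeroOne (b e)) (v : V) :
    IsZeroOne fun e => Γ.cellTrace n b e v := by
  intro e
  simp only [cellTrace]
  split_ifs <;> exact hb e _

variable (Γ) in
lemma cellPairing_eq (n : ℕ) (b η : E → ℕ → ℝ) :
    cellPairing n b η = ∑ e, ∑ k ∈ Finset.range n, (b e k - b e (k + 1)) * η e (k + 1) +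
      ∑ v, ∑ e ∈ Γ.incident v, Γ.cellTrace n b e v * Γ.nodeValue n η e v := by
  rw [sum_incident Γ fun e v => Γ.cellTrace n b e v * Γ.nodeValue n η e v,
    ← Finset.sum_add_distrib]
  refine Finset.sum_congr rfl fun e _ => ?_
  rw [sum_range_mul_sub]
  simp only [cellTrace, nodeValue, Γ.no_loops e, if_true, if_false]
  ring

lemma cellPairing_neg : cellPairing n b (-η) = -cellPairing n b η := by
  simp only [cellPairing, ← Finset.sum_neg_distrib]
  exact Finset.sum_congr rfl fun e _ => Finset.sum_congr rfl fun i _ => by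
    simp only [Pi.neg_apply]; ring

lemma IsNodalField.neg (hη : Γ.IsNodalField n η) : Γ.IsNodalField n (-η) where
  abs_le_one e i := by simpa using hη.abs_le_one e i
  kirchhoff v := by
    rw [← neg_eq_zero, ← Finset.sum_neg_distrib, ← hη.kirchhoff v]
    refine Finset.sum_congr rfl fun e _ => ?_
    unfold nodeValue
    split_ifs <;> simp

lemma IsNodalField.cellPairing_one (hη : Γ.IsNodalField n η) : cellPairing n 1 η = 0 := by
  rw [Γ.cellPairing_eq]
  simp [cellTrace, hη.kirchhoff]

lemma IsNodalField.abs_nodeValue_le_one (hη : Γ.IsNodalField n η) (e : E) (v : V) :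
    |Γ.nodeValue n η e v| ≤ 1 := by
  unfold nodeValue
  split_ifs
  · exact hη.abs_le_one e _
  · simpa only [abs_neg] using hη.abs_le_one e _

lemma IsNodalField.cellPairing_le_cut (hη : Γ.IsNodalField n η) (hb : ∀ e, IsZeroOne (b e)) :
    cellPairing n b η ≤ Γ.cut n b := by
  rw [Γ.cellPairing_eq, cut]
  refine add_le_add (Finset.sum_le_sum fun e _ => Finset.sum_le_sum fun k _ => ?_)
    (Finset.sum_le_sum fun v _ => sum_mul_le_min_sum (isZeroOne_cellTrace hb v).mem_Icc
      (fun e _ => hη.abs_nodeValue_le_one e v) (hη.kirchhoff v))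
  refine (le_abs_self _).trans ?_
  rw [abs_mul]
  exact mul_le_of_le_one_right (abs_nonneg _) (hη.abs_le_one e _)

theorem IsNodalField.abs_cellPairing_le_cut (hη : Γ.IsNodalField n η)
    (hb : ∀ e, IsZeroOne (b e)) : |cellPairing n b η| ≤ Γ.cut n b :=
  abs_le'.2 ⟨hη.cellPairing_le_cut hb, by
    simpa only [cellPairing_neg] using hη.neg.cellPairing_le_cut hb⟩

variable (Γ) in
theorem exists_nodalField_calibrating (n : ℕ) (a : E → ℕ → ℝ) :
    ∃ ζ, Γ.IsNodalField n ζ ∧ ∀ b : E → ℕ → ℝ, (∀ e, IsZeroOne (b e)) →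
      (∀ e i e' i', a e i ≤ a e' i' → b e i ≤ b e' i') → Γ.cut n b ≤ cellPairing n b ζ := by
  choose x m hx using fun v =>
    exists_isBalancedSign (Γ.incident v) fun e => Γ.cellTrace n a e v
  let ζ : E → ℕ → ℝ := fun e i =>
    if i = 0 then -x (Γ.src e) e else if i = n + 1 then x (Γ.tgt e) e
      else SignType.sign (a e (i - 1) - a e i)
  have hζ_node (v : V) (e : E) (he : e ∈ Γ.incident v) : Γ.nodeValue n ζ e v = x v e := by
    unfold nodeValue
    by_cases hv : v = Γ.tgt e
    · simp [ζ, hv]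
    · have : Γ.src e = v := (Γ.mem_incident.1 he).resolve_right fun h => hv h.symm
      simp [ζ, hv, this]
  refine ⟨ζ, ⟨fun e i => ?_, fun v => ?_⟩, fun b hb hmono => ?_⟩
  · simp only [ζ]
    split_ifs
    · simpa using (hx _).abs_le_one e
    · exact (hx _).abs_le_one e
    · rcases SignType.sign (a e (i - 1) - a e i) with _ | _ | _ <;> simp
  · rw [Finset.sum_congr rfl (hζ_node v), (hx v).sum_eq_zero]
  rw [Γ.cellPairing_eq, cut]
  refine add_le_add (Finset.sum_le_sum fun e _ => Finset.sum_le_sum fun k hk => ?_)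
    (Finset.sum_le_sum fun v _ => ?_)
  · have hkn : k ≠ n := (Finset.mem_range.1 hk).ne
    simpa [ζ, hkn] using (sub_mul_sign_sub (hmono e k e (k + 1)) (hmono e (k + 1) e k)).ge
  · rw [Finset.sum_congr rfl fun e he => by rw [hζ_node v e he]]
    refine (hx v).min_sum_le (isZeroOne_cellTrace hb v) fun e _ e' _ => ?_
    simp only [cellTrace]
    split_ifs <;> exact hmono _ _ _ _

lemma vertexCut_nonneg (hb : ∀ e, IsZeroOne (b e)) (v : V) : 0 ≤ Γ.vertexCut n b v := by
  have hmem := (isZeroOne_cellTrace (Γ := Γ) (n := n) hb v).mem_Icc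
  exact le_min (Finset.sum_nonneg fun e _ => (hmem e).1)
    (Finset.sum_nonneg fun e _ => sub_nonneg.2 (hmem e).2)

lemma sum_abs_sub_le_cut (hb : ∀ e, IsZeroOne (b e)) (e : E) :
    ∑ k ∈ Finset.range n, |b e k - b e (k + 1)| ≤ Γ.cut n b :=
  le_add_of_le_of_nonneg
    (Finset.single_le_sum (f := fun e => ∑ k ∈ Finset.range n, |b e k - b e (k + 1)|)
      (fun _ _ => Finset.sum_nonneg fun _ _ => abs_nonneg _) (Finset.mem_univ e))
    (Finset.sum_nonneg fun v _ => vertexCut_nonneg hb v)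

lemma vertexCut_le_cut (hb : ∀ e, IsZeroOne (b e)) (v : V) :
    Γ.vertexCut n b v ≤ Γ.cut n b :=
  le_add_of_nonneg_of_le (Finset.sum_nonneg fun _ _ => Finset.sum_nonneg fun _ _ => abs_nonneg _)
    (Finset.single_le_sum (fun v _ => vertexCut_nonneg hb v) (Finset.mem_univ v))

lemma cut_nonneg (hb : ∀ e, IsZeroOne (b e)) : 0 ≤ Γ.cut n b :=
  add_nonneg (Finset.sum_nonneg fun _ _ => Finset.sum_nonneg fun _ _ => abs_nonneg _)
    (Finset.sum_nonneg fun v _ => vertexCut_nonneg hb v)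

lemma eq_first_cell_of_cut_lt_one (hb : ∀ e, IsZeroOne (b e)) (hcut : Γ.cut n b < 1) (e : E)
    {i : ℕ} (hi : i ≤ n) : b e i = b e 0 := by
  induction i with
  | zero => rfl
  | succ k ih =>
    have hjump : |b e k - b e (k + 1)| ≤ ∑ k ∈ Finset.range n, |b e k - b e (k + 1)| :=
      Finset.single_le_sum (f := fun k => |b e k - b e (k + 1)|) (fun _ _ => abs_nonneg _)
        (Finset.mem_range.2 hi)
    rw [← (hb e).eq_of_abs_sub_lt_one (hjump.trans_lt ((sum_abs_sub_le_cut hb e).trans_lt hcut)),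
      ih (by omega)]

theorem eq_of_cut_lt_one (hb : ∀ e, IsZeroOne (b e)) (hcut : Γ.cut n b < 1) (e e' : E) {i i' : ℕ}
    (hi : i ≤ n) (hi' : i' ≤ n) : b e i = b e' i' := by
  have htrace (e : E) (v : V) : Γ.cellTrace n b e v = b e 0 := by
    unfold cellTrace
    split_ifs
    · exact eq_first_cell_of_cut_lt_one hb hcut e le_rfl
    · rfl
  have hvertex (v : V) (e : E) (he : e ∈ Γ.incident v) (e' : E) (he' : e' ∈ Γ.incident v) :
      b e 0 = b e' 0 := by
    simpa only [htrace] using (isZeroOne_cellTrace hb v).eq_of_min_sum_lt_one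
      ((vertexCut_le_cut hb v).trans_lt hcut) he he'
  rw [eq_first_cell_of_cut_lt_one hb hcut e hi, eq_first_cell_of_cut_lt_one hb hcut e' hi']
  exact Γ.eq_of_forall_incident (f := fun e => b e 0) hvertex e e'

end Cells

end CompactMetricGraph

section WeakDerivative

variable {a b : ℝ}

theorem setIntegral_Ioo_eq_intervalIntegral (hab : a ≤ b) (f : ℝ → ℝ) :
    ∫ t in Ioo a b, f t = ∫ t in a..b, f t := by
  rw [intervalIntegral.integral_of_le hab, integral_Ioc_eq_integral_Ioo]

theorem intervalIntegrable_of_memLp_Ioo {p : ℝ≥0∞} (hp : 1 ≤ p) {g : ℝ → ℝ} (hab : a ≤ b)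
    (hg : MemLp g p (volume.restrict (Ioo a b))) : IntervalIntegrable g volume a b :=
  (intervalIntegrable_iff_integrableOn_Ioo_of_le hab).2 (hg.integrable hp)

theorem continuousOn_primitive_Icc {g : ℝ → ℝ} (hab : a ≤ b)
    (hg : IntervalIntegrable g volume a b) : ContinuousOn (fun t => ∫ s in a..t, g s) (Icc a b) :=
  uIcc_of_le hab ▸ intervalIntegral.continuousOn_primitive_interval' hg left_mem_uIcc

theorem exists_Icc_between_of_isCompact {s : Set ℝ} (hs : IsCompact s) (hs_sub : s ⊆ Ioo a b) :
    ∃ c d, s ⊆ Icc c d ∧ Icc c d ⊆ Ioo a b := by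
  rcases s.eq_empty_or_nonempty with rfl | hne
  · exact ⟨1, 0, empty_subset _, by simp⟩
  · exact ⟨sInf s, sSup s, subset_Icc_csInf_csSup hs.bddBelow hs.bddAbove,
      Icc_subset_Ioo (hs_sub (hs.sInf_mem hne)).1 (hs_sub (hs.sSup_mem hne)).2⟩

namespace IsTestFun

variable {φ θ : ℝ → ℝ}

theorem apply_eq_zero (hφ : IsTestFun a b φ) {t : ℝ} (ht : t ∉ Ioo a b) : φ t = 0 :=
  image_eq_zero_of_notMem_tsupport fun h => ht (hφ.2.2 h)

theorem continuous_deriv (hφ : IsTestFun a b φ) : Continuous (deriv φ) :=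
  hφ.1.continuous_deriv (by simp)

theorem integral_eq_intervalIntegral (hφ : IsTestFun a b φ) (hab : a ≤ b) :
    ∫ t, φ t = ∫ t in a..b, φ t := by
  rw [← setIntegral_Ioo_eq_intervalIntegral hab]
  exact (setIntegral_eq_integral_of_forall_compl_eq_zero fun _ ht => hφ.apply_eq_zero ht).symm

theorem sub (hφ : IsTestFun a b φ) (hθ : IsTestFun a b θ) :
    IsTestFun a b fun t => φ t - θ t :=
  ⟨hφ.1.sub hθ.1, hφ.2.1.sub hθ.2.1,
    (tsupport_sub φ θ).trans (union_subset hφ.2.2 hθ.2.2)⟩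

theorem const_mul (hφ : IsTestFun a b φ) (c : ℝ) : IsTestFun a b fun t => c * φ t :=
  ⟨contDiff_const.mul hφ.1, hφ.2.1.mul_left, (tsupport_mul_subset_right).trans hφ.2.2⟩

theorem integral_primitive_mul_deriv (hφ : IsTestFun a b φ) {g : ℝ → ℝ} (hab : a ≤ b)
    (hg : IntervalIntegrable g volume a b) (c : ℝ) :
    ∫ t in Ioo a b, (c + ∫ s in a..t, g s) * deriv φ t = -∫ t in Ioo a b, g t * φ t := by
  have hF : AbsolutelyContinuousOnInterval (fun t => c + ∫ s in a..t, g s) a b :=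
    (contDiff_const.contDiffOn (n := 1)).absolutelyContinuousOnInterval.add
      (hg.absolutelyContinuousOnInterval_intervalIntegral left_mem_uIcc)
  have hφ' : AbsolutelyContinuousOnInterval φ a b :=
    (hφ.1.of_le (by simp)).contDiffOn.absolutelyContinuousOnInterval
  rw [setIntegral_Ioo_eq_intervalIntegral hab, setIntegral_Ioo_eq_intervalIntegral hab,
    hF.integral_mul_deriv_eq_deriv_mul hφ', hφ.apply_eq_zero (t := a) (by simp),
    hφ.apply_eq_zero (t := b) (by simp), mul_zero, mul_zero, sub_zero, zero_sub]
  congr 1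
  refine intervalIntegral.integral_congr_ae ?_
  filter_upwards [hg.ae_hasDerivAt_integral] with t ht htm
  rw [((ht (uIoc_subset_uIcc htm) a left_mem_uIcc).const_add c).deriv]

theorem primitive (hθ : IsTestFun a b θ) (h0 : ∫ t in a..b, θ t = 0) :
    IsTestFun a b fun x => ∫ t in a..x, θ t := by
  have hcont := hθ.1.continuous
  have hint (x y : ℝ) : IntervalIntegrable θ volume x y := hcont.intervalIntegrable x y
  obtain ⟨c, d, hθ_supp, hcd⟩ := exists_Icc_between_of_isCompact hθ.2.1 hθ.2.2
  have hsupp : tsupport (fun x => ∫ t in a..x, θ t) ⊆ Icc c d := by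
    refine closure_minimal (fun x hx => by_contra fun hx_notMem => hx ?_) isClosed_Icc
    have hθ_zero {y : ℝ} (hy : ∀ t ∈ Icc c d, t ∉ uIcc x y) : ∫ t in x..y, θ t = 0 := by
      refine intervalIntegral.integral_zero_ae (.of_forall fun t ht => ?_)
      exact image_eq_zero_of_notMem_tsupport fun h => hy t (hθ_supp h) (uIoc_subset_uIcc ht)
    rcases lt_or_ge x c with hxc | hcx
    · have hzero : ∫ t in x..a, θ t = 0 := hθ_zero fun t ht htx => by
        rcases mem_uIcc.1 htx with ⟨-, hta⟩ | ⟨-, htx⟩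
        · exact hta.not_gt (hcd ht).1
        · exact htx.not_gt (hxc.trans_le ht.1)
      exact (intervalIntegral.integral_symm x a).trans (by rw [hzero, neg_zero])
    · have hdx : d < x := lt_of_not_ge fun h => hx_notMem ⟨hcx, h⟩
      have hzero : ∫ t in x..b, θ t = 0 := hθ_zero fun t ht htx => by
        rcases mem_uIcc.1 htx with ⟨hxt, -⟩ | ⟨hbt, -⟩
        · exact hxt.not_gt (ht.2.trans_lt hdx)
        · exact hbt.not_gt (hcd ht).2
      rwa [← intervalIntegral.integral_add_adjacent_intervals (hint a x) (hint x b), hzero,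
        add_zero] at h0
  refine ⟨contDiff_infty_iff_deriv.2 ⟨?_, ?_⟩,
    .of_support_subset_isCompact isCompact_Icc ((subset_tsupport _).trans hsupp), hsupp.trans hcd⟩
  · exact fun x => (hcont.integral_hasStrictDerivAt a x).hasDerivAt.differentiableAt
  · simpa only [funext (hcont.deriv_integral θ a)] using hθ.1

end IsTestFun

theorem exists_isTestFun_integral_eq_one (hab : a < b) :
    ∃ ψ, IsTestFun a b ψ ∧ ∫ t, ψ t = 1 := by
  let ρ : ContDiffBump ((a + b) / 2) := ⟨(b - a) / 8, (b - a) / 4, by linarith, by linarith⟩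
  refine ⟨ρ.normed volume, ⟨ρ.contDiff_normed, ρ.hasCompactSupport_normed, ?_⟩,
    ρ.integral_normed⟩
  rw [ρ.tsupport_normed_eq, Real.closedBall_eq_Icc]
  exact Icc_subset_Ioo (by simp only [ρ]; linarith) (by simp only [ρ]; linarith)

/- The du Bois-Reymond lemma: every test function is the derivative of a test function plus a
multiple of a fixed one. -/
theorem exists_ae_eq_const_of_forall_integral_mul_deriv_eq_zero {F : ℝ → ℝ} (hab : a < b)
    (hF : IntegrableOn F (Ioo a b))
    (h : ∀ φ, IsTestFun a b φ → ∫ t in Ioo a b, F t * deriv φ t = 0) :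
    ∃ k, ∀ᵐ t ∂volume.restrict (Ioo a b), F t = k := by
  obtain ⟨ψ₀, hψ₀, hψ₀_one⟩ := exists_isTestFun_integral_eq_one hab
  have hint {ψ : ℝ → ℝ} (hψ : IsTestFun a b ψ) : IntegrableOn (fun t => F t * ψ t) (Ioo a b) := by
    obtain ⟨C, hC⟩ := hψ.2.1.exists_bound_of_continuous hψ.1.continuous
    exact hF.mul_bdd hψ.1.continuous.aestronglyMeasurable (.of_forall hC)
  set k := ∫ t in Ioo a b, F t * ψ₀ t
  have hpairing {ψ : ℝ → ℝ} (hψ : IsTestFun a b ψ) :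
      ∫ t in Ioo a b, F t * ψ t = (∫ t, ψ t) * k := by
    set θ : ℝ → ℝ := fun t => ψ t - (∫ t, ψ t) * ψ₀ t
    have hθ : IsTestFun a b θ := hψ.sub (hψ₀.const_mul _)
    have hθ_zero : ∫ t in a..b, θ t = 0 := by
      rw [← hθ.integral_eq_intervalIntegral hab.le, integral_sub, integral_const_mul, hψ₀_one,
        mul_one, sub_self]
      · exact hψ.1.continuous.integrable_of_hasCompactSupport hψ.2.1
      · exact (hψ₀.1.continuous.integrable_of_hasCompactSupport hψ₀.2.1).const_mul _
    have := h _ (hθ.primitive hθ_zero)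
    simp only [funext (hθ.1.continuous.deriv_integral θ a), θ, mul_sub,
      mul_left_comm (F _) (∫ t, ψ t)] at this
    rwa [integral_sub (hint hψ) ((hint hψ₀).const_mul _), integral_const_mul, sub_eq_zero] at this
  refine ⟨k, (ae_restrict_iff' measurableSet_Ioo).2 ?_⟩
  have hzero := isOpen_Ioo.ae_eq_zero_of_integral_contDiff_smul_eq_zero (μ := volume)
    (f := fun t => F t - k) (U := Ioo a b)
    (hF.sub (integrableOn_const (by simp))).locallyIntegrableOn fun ψ hψ hψ_cpt hψ_supp => ?_
  · exact hzero.mono fun t ht htm => sub_eq_zero.1 (ht htm)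
  have hψ' : IsTestFun a b ψ := ⟨hψ, hψ_cpt, hψ_supp⟩
  rw [← setIntegral_eq_integral_of_forall_compl_eq_zero (s := Ioo a b) fun t ht => by
    rw [hψ'.apply_eq_zero ht, zero_smul]]
  simp only [smul_eq_mul, mul_comm (ψ _), sub_mul]
  rw [integral_sub (hint hψ') ?_, hpairing hψ', integral_const_mul,
    setIntegral_Ioo_eq_intervalIntegral hab.le, hψ'.integral_eq_intervalIntegral hab.le, mul_comm,
    sub_self]
  exact (hψ.continuous.integrable_of_hasCompactSupport hψ_cpt).integrableOn.const_mul k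

theorem exists_eqOn_const_of_forall_integral_mul_deriv_eq_zero {F : ℝ → ℝ} (hab : a < b)
    (hF : ContinuousOn F (Icc a b))
    (h : ∀ φ, IsTestFun a b φ → ∫ t in Ioo a b, F t * deriv φ t = 0) :
    ∃ k, ∀ t ∈ Icc a b, F t = k := by
  obtain ⟨k, hk⟩ := exists_ae_eq_const_of_forall_integral_mul_deriv_eq_zero hab
    (hF.integrableOn_Icc.mono_set Ioo_subset_Icc_self) h
  rw [restrict_Ioo_eq_restrict_Icc] at hk
  exact ⟨k, Measure.eqOn_Icc_of_ae_eq volume hab.ne hk hF continuousOn_const⟩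

theorem isW12On_primitive {g : ℝ → ℝ} (hab : a ≤ b)
    (hg : MemLp g 2 (volume.restrict (Ioo a b))) (c : ℝ) :
    IsW12On a b (fun t => c + ∫ s in a..t, g s) g := by
  have hgi := intervalIntegrable_of_memLp_Ioo one_le_two hab hg
  have hcont : ContinuousOn (fun t => c + ∫ s in a..t, g s) (Icc a b) :=
    continuousOn_const.add (continuousOn_primitive_Icc hab hgi)
  refine ⟨hcont, ?_, hg, fun φ hφ => hφ.integral_primitive_mul_deriv hab hgi c⟩
  rw [restrict_Ioo_eq_restrict_Icc]
  obtain ⟨C, hC⟩ := isCompact_Icc.exists_bound_of_continuousOn hcont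
  exact .of_bound (hcont.aestronglyMeasurable measurableSet_Icc) C
    ((ae_restrict_mem measurableSet_Icc).mono hC)

theorem IsW12On.intervalIntegrable {z dz : ℝ → ℝ} (h : IsW12On a b z dz) (hab : a ≤ b) :
    IntervalIntegrable dz volume a b :=
  intervalIntegrable_of_memLp_Ioo one_le_two hab h.2.2.1

theorem IsW12On.integral_eq_sub {z dz : ℝ → ℝ} (h : IsW12On a b z dz) (hab : a < b) {s t : ℝ}
    (hs : s ∈ Icc a b) (ht : t ∈ Icc a b) : ∫ x in s..t, dz x = z t - z s := by
  have hi := h.intervalIntegrable hab.le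
  have hc := continuousOn_primitive_Icc hab.le hi
  obtain ⟨k, hk⟩ := exists_eqOn_const_of_forall_integral_mul_deriv_eq_zero hab (h.1.sub hc)
    fun φ hφ => by
      have hint {f : ℝ → ℝ} (hf : ContinuousOn f (Icc a b)) :
          IntegrableOn (fun t => f t * deriv φ t) (Ioo a b) :=
        (hf.mul hφ.continuous_deriv.continuousOn).integrableOn_Icc.mono_set Ioo_subset_Icc_self
      have hprim := hφ.integral_primitive_mul_deriv hab.le hi 0
      simp only [zero_add] at hprim
      simp only [Pi.sub_apply, sub_mul]
      rw [integral_sub (hint h.1) (hint hc), h.2.2.2 φ hφ, hprim, sub_self]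
  have hmono {u : ℝ} (hu : u ∈ Icc a b) : IntervalIntegrable dz volume a u :=
    hi.mono_set (uIcc_subset_uIcc_left (Icc_subset_uIcc hu))
  rw [← intervalIntegral.integral_interval_sub_left (hmono ht) (hmono hs)]
  linarith [hk s hs, hk t ht, Pi.sub_apply z (fun t => ∫ x in a..t, dz x) s,
    Pi.sub_apply z (fun t => ∫ x in a..t, dz x) t]

theorem abs_le_one_of_ae_of_continuousOn {z : ℝ → ℝ} (hab : a ≠ b) (hz : ContinuousOn z (Icc a b))
    (h : ∀ᵐ t ∂volume.restrict (Ioo a b), |z t| ≤ 1) : ∀ t ∈ Icc a b, |z t| ≤ 1 := by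
  rw [restrict_Ioo_eq_restrict_Icc] at h
  have := Measure.eqOn_Icc_of_ae_eq (f := fun t => max |z t| 1) (g := fun _ => (1 : ℝ)) volume
    hab (h.mono fun t ht => max_eq_right ht) (hz.abs.sup continuousOn_const) continuousOn_const
  exact fun t ht => max_eq_right_iff.1 (this ht)

end WeakDerivative

section Grid

open Filter Topology

variable {δ : ℝ} {c ζ : ℕ → ℝ} {u : ℝ → ℝ} {k : ℕ}

/-- The step function with value `c i` on the cell `[i δ, (i + 1) δ)` of the grid with mesh `δ`. -/
noncomputable def stepFun (δ : ℝ) (c : ℕ → ℝ) (t : ℝ) : ℝ := c ⌊t / δ⌋₊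

/-- The mean value of `u` over the cell `[i δ, (i + 1) δ)`. -/
noncomputable def cellAvg (δ : ℝ) (u : ℝ → ℝ) (i : ℕ) : ℝ :=
  ⨍ t in (i * δ)..((i + 1 : ℕ) * δ), u t

/-- The slope on the `i`-th cell of the piecewise affine function with the value `ζ j` at the node
`j δ` for all `j`. -/
noncomputable def nodeSlope (δ : ℝ) (ζ : ℕ → ℝ) (i : ℕ) : ℝ := (ζ (i + 1) - ζ i) / δ

/-- The piecewise affine function on `[0, ∞)` with the value `ζ j` at the node `j δ` for all `j`. -/
noncomputable def nodeInterp (δ : ℝ) (ζ : ℕ → ℝ) (t : ℝ) : ℝ :=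
  ζ 0 + ∫ s in (0 : ℝ)..t, stepFun δ (nodeSlope δ ζ) s

section Cell

theorem cell_length (i : ℕ) : (i + 1 : ℕ) * δ - i * δ = δ := by
  push_cast; ring

theorem cell_le (hδ : 0 < δ) (i : ℕ) : i * δ ≤ (i + 1 : ℕ) * δ := by
  gcongr; simp

theorem mem_cell_floor (hδ : 0 < δ) {t : ℝ} (ht : 0 ≤ t) :
    t ∈ Icc (⌊t / δ⌋₊ * δ) ((⌊t / δ⌋₊ + 1 : ℕ) * δ) := by
  rw [mem_Icc, ← le_div_iff₀ hδ, ← div_le_iff₀ hδ, Nat.cast_add_one]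
  exact ⟨Nat.floor_le (div_nonneg ht hδ.le), (Nat.lt_floor_add_one _).le⟩

theorem intervalIntegrable_cell (hδ : 0 < δ) (hu : IntervalIntegrable u volume 0 (k * δ)) {i : ℕ}
    (hi : i < k) : IntervalIntegrable u volume (i * δ) ((i + 1 : ℕ) * δ) := by
  refine hu.mono_set (uIcc_subset_uIcc ?_ ?_) <;> refine Icc_subset_uIcc ⟨by positivity, ?_⟩ <;>
    gcongr
  exact hi

end Cell

section StepFun

theorem measurable_stepFun : Measurable (stepFun δ c) :=
  (measurable_from_top (f := c)).comp (Nat.measurable_floor.comp (measurable_id.div_const δ))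

theorem stepFun_eq (hδ : 0 < δ) {i : ℕ} {t : ℝ} (h : i * δ ≤ t) (h' : t < (i + 1 : ℕ) * δ) :
    stepFun δ c t = c i := by
  rw [stepFun, (Nat.floor_eq_iff (div_nonneg (le_trans (by positivity) h) hδ.le)).2
    ⟨(le_div_iff₀ hδ).2 h, (div_lt_iff₀ hδ).2 (by exact_mod_cast h')⟩]

theorem abs_stepFun_le (hδ : 0 < δ) {t : ℝ} (ht : t ∈ Ioo 0 (k * δ)) :
    |stepFun δ c t| ≤ ∑ i ∈ Finset.range k, |c i| := by
  refine Finset.single_le_sum (f := fun i => |c i|) (fun i _ => abs_nonneg _)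
    (Finset.mem_range.2 ?_)
  rw [Nat.floor_lt (div_nonneg ht.1.le hδ.le), div_lt_iff₀ hδ]
  exact ht.2

theorem memLp_stepFun (hδ : 0 < δ) (p : ℝ≥0∞) :
    MemLp (stepFun δ c) p (volume.restrict (Ioo 0 (k * δ))) :=
  .of_bound measurable_stepFun.aestronglyMeasurable _
    ((ae_restrict_mem measurableSet_Ioo).mono fun _ ht => abs_stepFun_le hδ ht)

theorem intervalIntegrable_stepFun (hδ : 0 < δ) :
    IntervalIntegrable (stepFun δ c) volume 0 (k * δ) :=
  intervalIntegrable_of_memLp_Ioo le_rfl (by positivity) (memLp_stepFun hδ 1)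

theorem integral_comp_stepFun (hδ : 0 < δ) {F : ℝ → ℝ → ℝ}
    (hF : ∀ i < k, IntervalIntegrable (fun t => F t (c i)) volume (i * δ) ((i + 1 : ℕ) * δ)) :
    ∫ t in (0 : ℝ)..(k * δ), F t (stepFun δ c t) =
      ∑ i ∈ Finset.range k, ∫ t in (i * δ)..((i + 1 : ℕ) * δ), F t (c i) := by
  have hcell (i : ℕ) : EqOn (fun t => F t (c i)) (fun t => F t (stepFun δ c t))
      (uIoo (i * δ) ((i + 1 : ℕ) * δ)) := fun t ht => by
    rw [uIoo_of_le (cell_le hδ i)] at ht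
    simp only [stepFun_eq hδ ht.1.le ht.2]
  have hadd := intervalIntegral.sum_integral_adjacent_intervals (a := fun i : ℕ => i * δ)
    fun i hi => (hF i hi).congr_uIoo (hcell i)
  simp only [Nat.cast_zero, zero_mul] at hadd
  rw [← hadd]
  exact Finset.sum_congr rfl fun i _ => (intervalIntegral.integral_congr_uIoo (hcell i)).symm

theorem integral_stepFun_mul (hδ : 0 < δ) (hu : IntervalIntegrable u volume 0 (k * δ)) :
    ∫ t in (0 : ℝ)..(k * δ), stepFun δ c t * u t =
      ∑ i ∈ Finset.range k, c i * ∫ t in (i * δ)..((i + 1 : ℕ) * δ), u t := by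
  simp only [← intervalIntegral.integral_const_mul]
  exact integral_comp_stepFun (F := fun t x => x * u t) hδ
    fun i hi => (intervalIntegrable_cell hδ hu hi).const_mul (c i)

end StepFun

section Interpolation

theorem nodeInterp_node (hδ : 0 < δ) (k : ℕ) : nodeInterp δ ζ (k * δ) = ζ k := by
  have h := integral_comp_stepFun (c := nodeSlope δ ζ) (k := k) (F := fun _ x => x) hδ
    fun _ _ => intervalIntegrable_const
  simp only [intervalIntegral.integral_const, cell_length, smul_eq_mul, nodeSlope,
    mul_div_cancel₀ _ hδ.ne', Finset.sum_range_sub] at h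
  simp only [nodeInterp, h]
  ring

theorem nodeInterp_eq_lineMap (hδ : 0 < δ) {i : ℕ} {t : ℝ}
    (ht : t ∈ Icc (i * δ) ((i + 1 : ℕ) * δ)) :
    nodeInterp δ ζ t = AffineMap.lineMap (ζ i) (ζ (i + 1)) ((t - i * δ) / δ) := by
  have hint := intervalIntegrable_stepFun (c := nodeSlope δ ζ) (k := i + 1) hδ
  have hint' {s : ℝ} (hs : s ∈ Icc 0 ((i + 1 : ℕ) * δ)) :
      IntervalIntegrable (stepFun δ (nodeSlope δ ζ)) volume 0 s :=
    hint.mono_set (uIcc_subset_uIcc_left (Icc_subset_uIcc hs))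
  have hsub := intervalIntegral.integral_interval_sub_left
    (hint' ⟨le_trans (by positivity) ht.1, ht.2⟩) (hint' ⟨by positivity, cell_le hδ i⟩)
  rw [intervalIntegral.integral_congr_Ioo_of_le (g := fun _ => nodeSlope δ ζ i) ht.1
    fun s hs => stepFun_eq hδ hs.1.le (hs.2.trans_le ht.2), intervalIntegral.integral_const,
    smul_eq_mul] at hsub
  have hnode := nodeInterp_node (ζ := ζ) hδ i
  rw [nodeInterp] at hnode ⊢
  rw [AffineMap.lineMap_apply_ring', div_mul_eq_mul_div, mul_div_assoc, ← nodeSlope, ← hsub]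
  linarith

theorem abs_nodeInterp_le (hδ : 0 < δ) {C : ℝ} (hζ : ∀ i, |ζ i| ≤ C) {t : ℝ} (ht : 0 ≤ t) :
    |nodeInterp δ ζ t| ≤ C := by
  have hcell := mem_cell_floor hδ ht
  rw [nodeInterp_eq_lineMap hδ hcell, abs_le]
  refine (convex_Icc (-C) C).lineMap_mem (abs_le.1 (hζ _)) (abs_le.1 (hζ _))
    ⟨div_nonneg (sub_nonneg.2 hcell.1) hδ.le, (div_le_one hδ).2 ?_⟩
  linarith [hcell.2, cell_length (δ := δ) ⌊t / δ⌋₊]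

theorem isW12On_nodeInterp (hδ : 0 < δ) :
    IsW12On 0 (k * δ) (nodeInterp δ ζ) (stepFun δ (nodeSlope δ ζ)) :=
  isW12On_primitive (by positivity) (memLp_stepFun hδ 2) (ζ 0)

theorem integral_mul_nodeSlope (hδ : 0 < δ) (hu : IntervalIntegrable u volume 0 (k * δ)) :
    ∫ t in Ioo 0 (k * δ), u t * stepFun δ (nodeSlope δ ζ) t =
      ∑ i ∈ Finset.range k, cellAvg δ u i * (ζ (i + 1) - ζ i) := by
  simp only [mul_comm (u _)]
  rw [setIntegral_Ioo_eq_intervalIntegral (by positivity), integral_stepFun_mul hδ hu]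
  refine Finset.sum_congr rfl fun i _ => ?_
  rw [cellAvg, interval_average_eq_div, cell_length, nodeSlope]
  ring

end Interpolation

section CellAverages

theorem integral_abs_sub_le_add {a b : ℝ} (hab : a ≤ b) {f g h : ℝ → ℝ}
    (hf : IntervalIntegrable f volume a b) (hg : IntervalIntegrable g volume a b)
    (hh : IntervalIntegrable h volume a b) :
    ∫ t in a..b, |f t - h t| ≤ (∫ t in a..b, |f t - g t|) + ∫ t in a..b, |g t - h t| := by
  rw [← intervalIntegral.integral_add (hf.sub hg).abs (hg.sub hh).abs]
  exact intervalIntegral.integral_mono_on hab (hf.sub hh).abs ((hf.sub hg).abs.add (hg.sub hh).abs)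
    fun t _ => abs_sub_le _ _ _

theorem integral_abs_sub_average_le {a b : ℝ} (hab : a < b) (hu : IntervalIntegrable u volume a b)
    (x : ℝ) : ∫ t in a..b, |u t - ⨍ s in a..b, u s| ≤ 2 * ∫ t in a..b, |u t - x| := by
  have havg : ∫ t in a..b, (u t - x) = (b - a) * ((⨍ s in a..b, u s) - x) := by
    rw [intervalIntegral.integral_sub hu intervalIntegrable_const, intervalIntegral.integral_const,
      smul_eq_mul, interval_average_eq_div, mul_sub, mul_div_cancel₀ _ (sub_ne_zero.2 hab.ne')]
  have hdev : (b - a) * |x - ⨍ s in a..b, u s| ≤ ∫ t in a..b, |u t - x| := by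
    rw [abs_sub_comm, ← abs_of_pos (sub_pos.2 hab), ← abs_mul, ← havg]
    exact intervalIntegral.abs_integral_le_integral_abs hab.le
  have htri := integral_abs_sub_le_add hab.le hu (intervalIntegrable_const (c := x))
    (intervalIntegrable_const (c := ⨍ s in a..b, u s))
  rw [intervalIntegral.integral_const (|x - _|), smul_eq_mul] at htri
  linarith

theorem integral_abs_sub_stepFun_cellAvg_le (hδ : 0 < δ)
    (hu : IntervalIntegrable u volume 0 (k * δ)) (c : ℕ → ℝ) :
    ∫ t in (0 : ℝ)..(k * δ), |u t - stepFun δ (cellAvg δ u) t| ≤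
      2 * ∫ t in (0 : ℝ)..(k * δ), |u t - stepFun δ c t| := by
  have hint (c : ℕ → ℝ) (i : ℕ) (hi : i < k) :
      IntervalIntegrable (fun t => |u t - c i|) volume (i * δ) ((i + 1 : ℕ) * δ) :=
    ((intervalIntegrable_cell hδ hu hi).sub intervalIntegrable_const).abs
  rw [integral_comp_stepFun (F := fun t x => |u t - x|) hδ (hint _),
    integral_comp_stepFun (F := fun t x => |u t - x|) hδ (hint c), Finset.mul_sum]
  refine Finset.sum_le_sum fun i hi => integral_abs_sub_average_le ?_
    (intervalIntegrable_cell hδ hu (Finset.mem_range.1 hi)) (c i)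
  linarith [cell_length (δ := δ) i]

theorem tendsto_stepFun_sample {ι : Type*} {l : Filter ι} {δ : ι → ℝ} (hδ : ∀ n, 0 < δ n)
    (hδ_lim : Tendsto δ l (𝓝 0)) {g : ℝ → ℝ} (hg : Continuous g) {t : ℝ} (ht : 0 ≤ t) :
    Tendsto (fun n => stepFun (δ n) (fun i => g (i * δ n)) t) l (𝓝 (g t)) := by
  refine (hg.tendsto t).comp (tendsto_iff_dist_tendsto_zero.2 ?_)
  refine squeeze_zero (fun _ => dist_nonneg) (fun n => ?_) hδ_lim
  have hcell := mem_cell_floor (hδ n) ht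
  rw [dist_comm, Real.dist_eq, abs_of_nonneg (sub_nonneg.2 hcell.1)]
  linarith [hcell.2, cell_length (δ := δ n) ⌊t / δ n⌋₊]

theorem tendsto_integral_abs_sub_stepFun_sample {l C : ℝ} (hl : 0 ≤ l) {δ : ℕ → ℝ}
    (hδ : ∀ n, 0 < δ n) (hδ_lim : Tendsto δ atTop (𝓝 0)) {g : ℝ → ℝ} (hg : Continuous g)
    (hg_bdd : ∀ t, |g t| ≤ C) :
    Tendsto (fun n => ∫ t in (0 : ℝ)..l, |g t - stepFun (δ n) (fun i => g (i * δ n)) t|) atTop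
      (𝓝 0) := by
  suffices h : Tendsto (fun n => ∫ t in (0 : ℝ)..l, |g t - stepFun (δ n) (fun i => g (i * δ n)) t|)
      atTop (𝓝 (∫ _ in (0 : ℝ)..l, 0)) by simpa using h
  refine intervalIntegral.tendsto_integral_filter_of_dominated_convergence (fun _ => 2 * C)
    (.of_forall fun n => ?_) (.of_forall fun n => .of_forall fun t _ => ?_)
    intervalIntegrable_const (.of_forall fun t ht => ?_)
  · exact (hg.measurable.sub measurable_stepFun).norm.aestronglyMeasurable
  · rw [Real.norm_eq_abs, abs_abs, two_mul]
    exact (abs_sub _ _).trans (add_le_add (hg_bdd _) (hg_bdd _))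
  · rw [uIoc_of_le hl] at ht
    simpa using ((tendsto_stepFun_sample hδ hδ_lim hg ht.1.le).const_sub (g t)).abs

theorem exists_continuous_bounded_integral_abs_sub_le {l : ℝ} (hl : 0 ≤ l)
    (hu : IntervalIntegrable u volume 0 l) {ε : ℝ} (hε : 0 < ε) :
    ∃ g : ℝ → ℝ, Continuous g ∧ (∃ C, ∀ t, |g t| ≤ C) ∧ ∫ t in (0 : ℝ)..l, |u t - g t| ≤ ε := by
  rw [intervalIntegrable_iff_integrableOn_Ioc_of_le hl] at hu
  obtain ⟨g, hg_cpt, hg, hg_cont, -⟩ := hu.exists_hasCompactSupport_integral_sub_le hε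
  refine ⟨g, hg_cont, hg_cpt.exists_bound_of_continuous hg_cont, ?_⟩
  rwa [intervalIntegral.integral_of_le hl]

theorem tendsto_integral_abs_sub_stepFun_cellAvg {l : ℝ} (hl : 0 < l)
    (hu : IntervalIntegrable u volume 0 l) :
    Tendsto (fun n : ℕ => ∫ t in (0 : ℝ)..l,
      |u t - stepFun (l / (n + 1 : ℕ)) (cellAvg (l / (n + 1 : ℕ)) u) t|) atTop (𝓝 0) := by
  have hδ (n : ℕ) : 0 < l / (n + 1 : ℕ) := by positivity
  have hmul (n : ℕ) : ((n + 1 : ℕ) : ℝ) * (l / (n + 1 : ℕ)) = l := by field_simp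
  have hδ_lim : Tendsto (fun n : ℕ => l / (n + 1 : ℕ)) atTop (𝓝 0) :=
    (tendsto_const_div_atTop_nhds_zero_nat l).comp (tendsto_add_atTop_nat 1)
  refine tendsto_order.2 ⟨fun x hx => .of_forall fun n => hx.trans_le ?_, fun ε hε => ?_⟩
  · exact intervalIntegral.integral_nonneg hl.le fun _ _ => abs_nonneg _
  obtain ⟨g, hg, ⟨C, hC⟩, hug⟩ := exists_continuous_bounded_integral_abs_sub_le hl.le hu
    (show 0 < ε / 4 by positivity)
  have hsample := tendsto_integral_abs_sub_stepFun_sample hl.le hδ hδ_lim hg hC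
  filter_upwards [hsample.eventually_lt_const (show 0 < ε / 4 by positivity)] with n hn
  set S := stepFun (l / (n + 1 : ℕ)) fun i => g (i * (l / (n + 1 : ℕ)))
  have hu' : IntervalIntegrable u volume 0 ((n + 1 : ℕ) * (l / (n + 1 : ℕ))) := (hmul n).symm ▸ hu
  have hbest := integral_abs_sub_stepFun_cellAvg_le (hδ n) hu' fun i => g (i * (l / (n + 1 : ℕ)))
  have hS : IntervalIntegrable S volume 0 ((n + 1 : ℕ) * (l / (n + 1 : ℕ))) :=
    intervalIntegrable_stepFun (hδ n)
  rw [hmul n] at hbest hS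
  linarith [integral_abs_sub_le_add hl.le hu (hg.intervalIntegrable _ _) hS]

theorem integral_abs_sub_le_add_sum_cellAvg (hδ : 0 < δ)
    (hu : IntervalIntegrable u volume 0 (k * δ)) (m : ℝ) :
    ∫ t in (0 : ℝ)..(k * δ), |u t - m| ≤
      (∫ t in (0 : ℝ)..(k * δ), |u t - stepFun δ (cellAvg δ u) t|) +
        ∑ i ∈ Finset.range k, |cellAvg δ u i - m| * δ := by
  have hstep := intervalIntegrable_stepFun (c := cellAvg δ u) (k := k) hδ
  have hsum := integral_comp_stepFun (c := cellAvg δ u) (k := k) (F := fun _ x => |x - m|) hδ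
    fun _ _ => intervalIntegrable_const
  simp only [intervalIntegral.integral_const, cell_length, smul_eq_mul, mul_comm δ] at hsum
  rw [← hsum]
  exact integral_abs_sub_le_add (by positivity) hu hstep intervalIntegrable_const

end CellAverages

end Grid

lemma le_half_add_of_le {a b : ℝ≥0∞} (h : a ≤ b) : a ≤ (a + b) / 2 := by
  rw [ENNReal.le_div_iff_mul_le (.inl two_ne_zero) (.inl ENNReal.ofNat_ne_top), mul_two]
  gcongr

namespace CompactMetricGraph

variable {V E : Type*} [Fintype V] [Fintype E] (Γ : CompactMetricGraph V E)

section Length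

lemma coords_ae_eq (A : Set Γ.Point) (e : E) :
    Γ.coords A e =ᵐ[volume] (Ioo 0 (Γ.len e) ∩ Γ.pt e ⁻¹' A : Set ℝ) :=
  ae_eq_set_inter Ioo_ae_eq_Icc.symm (ae_eq_refl _)

lemma length_eq (A : Set Γ.Point) :
    Γ.length A = ∑ e, volume (Ioo 0 (Γ.len e) ∩ Γ.pt e ⁻¹' A : Set ℝ) :=
  Finset.sum_congr rfl fun e _ => measure_congr (Γ.coords_ae_eq A e)

lemma length_empty : Γ.length ∅ = 0 := by
  rw [length_eq]
  simp

lemma measSet_iff {A : Set Γ.Point} : Γ.MeasSet A ↔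
    ∀ e, NullMeasurableSet (Γ.pt e ⁻¹' A) (volume.restrict (Ioo 0 (Γ.len e))) :=
  forall_congr' fun e => by
    rw [nullMeasurableSet_restrict measurableSet_Ioo.nullMeasurableSet, inter_comm]
    exact ⟨fun h => h.congr (Γ.coords_ae_eq A e), fun h => h.congr (Γ.coords_ae_eq A e).symm⟩

lemma length_univ : Γ.length univ = ENNReal.ofReal (∑ e, Γ.len e) := by
  rw [length_eq, ENNReal.ofReal_sum_of_nonneg fun e _ => (Γ.len_pos e).le]
  simp

variable {Γ} {A D : Set Γ.Point} {u : Γ.Point → ℝ}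

lemma MeasSet.compl (hD : Γ.MeasSet D) : Γ.MeasSet Dᶜ :=
  Γ.measSet_iff.2 fun e => (Γ.measSet_iff.1 hD e).compl

lemma MeasSet.length_add_length_compl (hA : Γ.MeasSet A) :
    Γ.length A + Γ.length Aᶜ = Γ.length univ := by
  simp only [length_eq, ← Finset.sum_add_distrib]
  refine Finset.sum_congr rfl fun e _ => ?_
  have h := measure_add_measure_compl₀ (Γ.measSet_iff.1 hA e)
  rwa [Measure.restrict_apply' measurableSet_Ioo, Measure.restrict_apply' measurableSet_Ioo,
    Measure.restrict_apply' measurableSet_Ioo, ← preimage_compl, inter_comm,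
    inter_comm _ (Ioo _ _), inter_comm univ] at h

lemma MemL1.intervalIntegrable (hu : Γ.MemL1 u) (e : E) :
    IntervalIntegrable (Γ.onEdge u e) volume 0 (Γ.len e) :=
  (intervalIntegrable_iff_integrableOn_Ioo_of_le (Γ.len_pos e).le).2 (hu e)

lemma MemL1.aemeasurable (hu : Γ.MemL1 u) (e : E) :
    AEMeasurable (Γ.onEdge u e) (volume.restrict (Ioo 0 (Γ.len e))) :=
  (hu e).aestronglyMeasurable.aemeasurable

lemma MemL1.l1norm_sub_eq_ofReal (hu : Γ.MemL1 u) (c : ℝ) :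
    Γ.l1norm (fun x => u x - c) =
      ENNReal.ofReal (∑ e, ∫ t in (0 : ℝ)..Γ.len e, |Γ.onEdge u e t - c|) := by
  rw [ENNReal.ofReal_sum_of_nonneg fun e _ =>
    intervalIntegral.integral_nonneg (Γ.len_pos e).le fun t _ => abs_nonneg _]
  refine Finset.sum_congr rfl fun e _ => ?_
  have hint : IntegrableOn (fun t => Γ.onEdge u e t - c) (Ioo 0 (Γ.len e)) :=
    (hu e).sub (integrableOn_const (by simp))
  rw [← setIntegral_Ioo_eq_intervalIntegral (Γ.len_pos e).le, eLpNorm_one_eq_lintegral_enorm]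
  exact (ofReal_integral_norm_eq_lintegral_enorm hint).symm

lemma MemL1.aeConst_iff (hu : Γ.MemL1 u) :
    Γ.AEConst u ↔ ∃ c : ℝ, Γ.l1norm (fun x => u x - c) = 0 := by
  refine exists_congr fun c => ?_
  simp only [l1norm, Finset.sum_eq_zero_iff, Finset.mem_univ, true_imp_iff]
  refine forall_congr' fun e => ?_
  have hmeas : AEStronglyMeasurable (fun t => Γ.onEdge u e t - c)
      (volume.restrict (Ioo 0 (Γ.len e))) :=
    (hu e).aestronglyMeasurable.sub aestronglyMeasurable_const
  refine Iff.trans (Filter.eventually_congr (.of_forall fun t => ?_))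
    (eLpNorm_eq_zero_iff hmeas one_ne_zero).symm
  exact sub_eq_zero.symm

lemma l1norm_eq_length {f : Γ.Point → ℝ} (hA : Γ.MeasSet A)
    (hf : ∀ x, |f x| = A.indicator 1 x) : Γ.l1norm f = Γ.length A := by
  rw [length_eq]
  refine Finset.sum_congr rfl fun e _ => ?_
  have h (t : ℝ) : ‖Γ.onEdge f e t‖ₑ = (Γ.pt e ⁻¹' A).indicator (fun _ => 1) t := by
    rw [Real.enorm_eq_ofReal_abs, onEdge, hf]
    by_cases ht : Γ.pt e t ∈ A <;> simp [ht]
  rw [eLpNorm_one_eq_lintegral_enorm, lintegral_congr h,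
    lintegral_indicator_const₀ (Γ.measSet_iff.1 hA e), one_mul,
    Measure.restrict_apply' measurableSet_Ioo, inter_comm]

lemma MeasSet.memL1_indicator (hD : Γ.MeasSet D) : Γ.MemL1 (D.indicator fun _ => 1) :=
  fun e => (integrable_const (1 : ℝ)).indicator₀ (Γ.measSet_iff.1 hD e)

end Length

section Medians

variable {Γ} {D : Set Γ.Point} {u : Γ.Point → ℝ} {m : ℝ}

variable (Γ) in
/-- The distribution of the values of `u` with respect to the length; it reduces statements about
medians on the graph to measures on the line. -/
noncomputable def valueDist (u : Γ.Point → ℝ) : Measure ℝ :=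
  ∑ e, (volume.restrict (Ioo 0 (Γ.len e))).map (Γ.onEdge u e)

instance : IsFiniteMeasure (Γ.valueDist u) := by
  unfold valueDist
  infer_instance

lemma MemL1.valueDist_apply (hu : Γ.MemL1 u) {B : Set ℝ} (hB : MeasurableSet B) :
    Γ.valueDist u B = Γ.length (u ⁻¹' B) := by
  rw [valueDist, Measure.finsetSum_apply, length_eq]
  refine Finset.sum_congr rfl fun e _ => ?_
  rw [Measure.map_apply_of_aemeasurable (hu.aemeasurable e) hB,
    Measure.restrict_apply' measurableSet_Ioo, inter_comm]
  rfl

lemma MemL1.l1norm_sub_eq_lintegral (hu : Γ.MemL1 u) (c : ℝ) :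
    Γ.l1norm (fun x => u x - c) = ∫⁻ x, edist x c ∂Γ.valueDist u := by
  rw [valueDist, lintegral_finsetSum_measure, l1norm]
  refine Finset.sum_congr rfl fun e _ => ?_
  rw [lintegral_map' (by fun_prop) (hu.aemeasurable e), eLpNorm_one_eq_lintegral_enorm]
  simp only [edist_eq_enorm_sub, onEdge]

lemma MemL1.isMedian_iff (hu : Γ.MemL1 u) :
    Γ.IsMedian u m ↔ IsDistributionMedian (Γ.valueDist u) m := by
  rw [IsDistributionMedian, hu.valueDist_apply measurableSet_Iio,
    hu.valueDist_apply measurableSet_Ioi, hu.valueDist_apply MeasurableSet.univ]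
  rfl

theorem MemL1.exists_isMedian (hu : Γ.MemL1 u) : ∃ m, Γ.IsMedian u m :=
  (exists_isDistributionMedian (Γ.valueDist u)).imp fun _ => hu.isMedian_iff.2

theorem IsMedian.l1norm_le (hm : Γ.IsMedian u m) (hu : Γ.MemL1 u) (c : ℝ) :
    Γ.l1norm (fun x => u x - m) ≤ Γ.l1norm (fun x => u x - c) := by
  rw [hu.l1norm_sub_eq_lintegral, hu.l1norm_sub_eq_lintegral]
  exact (hu.isMedian_iff.1 hm).lintegral_edist_le c

theorem MeasSet.exists_isMedian_indicator (hD : Γ.MeasSet D) :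
    ∃ m : ℝ, Γ.IsMedian (D.indicator fun _ => 1) m ∧
      Γ.l1norm (fun x => D.indicator (fun _ => 1) x - m) = min (Γ.length D) (Γ.length Dᶜ) := by
  rcases le_total (Γ.length D) (Γ.length Dᶜ) with h | h
  · have hlt : {x | D.indicator (fun _ => (1 : ℝ)) x < 0} = ∅ := by
      ext x; by_cases hx : x ∈ D <;> simp [hx]
    have hgt : {x | 0 < D.indicator (fun _ => (1 : ℝ)) x} = D := by
      ext x; by_cases hx : x ∈ D <;> simp [hx]
    refine ⟨0, ⟨?_, ?_⟩, ?_⟩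
    · simp only [hlt, length_empty, zero_le]
    · rw [hgt, ← hD.length_add_length_compl]
      exact le_half_add_of_le h
    · rw [min_eq_left h]
      exact l1norm_eq_length hD fun x => by by_cases hx : x ∈ D <;> simp [hx]
  · have hlt : {x | D.indicator (fun _ => (1 : ℝ)) x < 1} = Dᶜ := by
      ext x; by_cases hx : x ∈ D <;> simp [hx]
    have hgt : {x | 1 < D.indicator (fun _ => (1 : ℝ)) x} = ∅ := by
      ext x; by_cases hx : x ∈ D <;> simp [hx]
    refine ⟨1, ⟨?_, ?_⟩, ?_⟩
    · rw [hlt, ← hD.length_add_length_compl, add_comm]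
      exact le_half_add_of_le h
    · simp only [hgt, length_empty, zero_le]
    · rw [min_eq_right h]
      exact l1norm_eq_length hD.compl fun x => by by_cases hx : x ∈ D <;> simp [hx]

theorem MeasSet.not_aeConst_indicator (hD : Γ.MeasSet D) (hpos : 0 < Γ.length D)
    (hlt : Γ.length D < Γ.length univ) : ¬ Γ.AEConst (D.indicator fun _ => 1) := by
  rw [hD.memL1_indicator.aeConst_iff]
  rintro ⟨c, hc⟩
  obtain ⟨m, hm, hmin⟩ := hD.exists_isMedian_indicator
  have hle := hm.l1norm_le hD.memL1_indicator c
  rw [hc, hmin, min_le_iff, nonpos_iff_eq_zero, nonpos_iff_eq_zero] at hle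
  refine hle.elim hpos.ne' fun hcompl => hlt.ne ?_
  rw [← hD.length_add_length_compl, hcompl, add_zero]

end Medians

section GridIsoperimetry

/-- The length of the cells of the edge `e` in the grid with `n + 1` cells on each edge. -/
noncomputable def cellLength (n : ℕ) (e : E) : ℝ := Γ.len e / (n + 1 : ℕ)

/-- The length of the set described by the `0`-`1` pattern `b` on the cells. -/
noncomputable def gridLength (n : ℕ) (b : E → ℕ → ℝ) : ℝ :=
  ∑ e, ∑ i ∈ Finset.range (n + 1), b e i * Γ.cellLength n e

/-- The length of the smaller one of the set described by the pattern `b` and its complement. -/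
noncomputable def gridMinLength (n : ℕ) (b : E → ℕ → ℝ) : ℝ :=
  min (Γ.gridLength n b) (Γ.gridLength n (1 - b))

/-- The isoperimetric inequality with constant `κ` for sets that are unions of cells of a grid, with
the combinatorial perimeter. -/
def GridIsoperimetric (κ : ℝ) : Prop :=
  ∀ (n : ℕ) (b : E → ℕ → ℝ), (∀ e, IsZeroOne (b e)) →
    κ * Γ.gridMinLength n b ≤ Γ.cut n b

lemma cellLength_pos (n : ℕ) (e : E) : 0 < Γ.cellLength n e :=
  div_pos (Γ.len_pos e) (by positivity)

lemma mul_cellLength (n : ℕ) (e : E) : ((n + 1 : ℕ) : ℝ) * Γ.cellLength n e = Γ.len e := by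
  unfold cellLength
  field_simp

variable {Γ} {κ m : ℝ} {u : Γ.Point → ℝ}

/-- A single field tests all superlevel sets at once, so that the isoperimetric inequality
integrates over the levels. -/
theorem GridIsoperimetric.exists_nodalField (hκ : Γ.GridIsoperimetric κ) (n : ℕ)
    (a : E → ℕ → ℝ) : ∃ ζ, Γ.IsNodalField n ζ ∧ ∃ m : ℝ,
      κ * ∑ e, ∑ i ∈ Finset.range (n + 1), |a e i - m| * Γ.cellLength n e ≤
        cellPairing n a ζ := by
  obtain ⟨ζ, hζ, hcal⟩ := Γ.exists_nodalField_calibrating n a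
  refine ⟨ζ, hζ, ?_⟩
  have hsum (f : E → ℕ → ℝ) : ∑ e, ∑ i ∈ Finset.range (n + 1), f e i =
      ∑ p ∈ Finset.univ ×ˢ Finset.range (n + 1), f p.1 p.2 :=
    (Finset.sum_product _ _ fun p : E × ℕ => f p.1 p.2).symm
  simp only [cellPairing, hsum] at hcal ⊢
  refine exists_mul_sum_abs_sub_le (fun p _ => (Γ.cellLength_pos n p.1).le) ?_
    fun P _ hP => ?_
  · simpa only [cellPairing, hsum, Pi.one_apply, one_mul] using hζ.cellPairing_one
  let b : E → ℕ → ℝ := fun e i => if P (a e i) then 1 else 0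
  have hb (e : E) : IsZeroOne (b e) := fun i => by
    simp only [b]
    split_ifs <;> simp
  have hmono (e : E) (i : ℕ) (e' : E) (i' : ℕ) (h : a e i ≤ a e' i') : b e i ≤ b e' i' := by
    have := @hP _ _ h
    simp only [b]
    split_ifs <;> simp_all
  have hiso := (hκ n b hb).trans (hcal b hb hmono)
  have hnot (e : E) (i : ℕ) : (1 - b) e i = if ¬ P (a e i) then 1 else 0 := by
    simp only [b, Pi.sub_apply, Pi.one_apply]
    split_ifs <;> simp_all
  simp only [gridMinLength, gridLength, hnot, hsum] at hiso
  simpa only [b, ite_mul, one_mul, zero_mul, ← Finset.sum_filter] using hiso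

lemma MemBV.le_TV (hu : Γ.MemBV u) {z dz : E → ℝ → ℝ} (hz : Γ.IsKirchhoffField z dz)
    (hz_le : Γ.SupNormLeOne z) :
    ENNReal.ofReal |∑ e, ∫ t in Ioo 0 (Γ.len e), Γ.onEdge u e t * dz e t| ≤ Γ.TV u := by
  rw [TV, if_pos hu]
  exact le_iSup_of_le z (le_iSup_of_le dz (le_iSup_of_le hz (le_iSup_of_le hz_le le_rfl)))

lemma MemBV.cellPairing_le_TV (hu : Γ.MemBV u) {n : ℕ} {ζ : E → ℕ → ℝ}
    (hζ : Γ.IsNodalField n ζ) :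
    ENNReal.ofReal (cellPairing n (fun e => cellAvg (Γ.cellLength n e) (Γ.onEdge u e)) ζ) ≤
      Γ.TV u := by
  have hδ := Γ.cellLength_pos n
  have hlen := Γ.mul_cellLength n
  let z (e : E) := nodeInterp (Γ.cellLength n e) (ζ e)
  have hz_zero (e : E) : z e 0 = ζ e 0 := by
    simpa using nodeInterp_node (ζ := ζ e) (hδ e) 0
  have hz_len (e : E) : z e (Γ.len e) = ζ e (n + 1) := by
    rw [← nodeInterp_node (ζ := ζ e) (hδ e), hlen]
  have hz : Γ.IsKirchhoffField z
      fun e => stepFun (Γ.cellLength n e) (nodeSlope (Γ.cellLength n e) (ζ e)) := by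
    refine ⟨fun e => ?_, fun v => ?_⟩
    · simpa only [hlen] using isW12On_nodeInterp (ζ := ζ e) (k := n + 1) (hδ e)
    · simpa only [vertexValue, nodeValue, hz_zero, hz_len] using hζ.kirchhoff v
  have hz_le : Γ.SupNormLeOne z := fun e => (ae_restrict_mem measurableSet_Ioo).mono fun t ht =>
    abs_nodeInterp_le (hδ e) (hζ.abs_le_one e) ht.1.le
  refine le_trans (ENNReal.ofReal_le_ofReal ((le_of_eq ?_).trans (le_abs_self _)))
    (hu.le_TV hz hz_le)
  refine Finset.sum_congr rfl fun e _ => ?_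
  have hint : IntervalIntegrable (Γ.onEdge u e) volume 0 ((n + 1 : ℕ) * Γ.cellLength n e) := by
    simpa only [hlen] using MemL1.intervalIntegrable (fun e => (hu e).1) e
  simpa only [hlen] using (integral_mul_nodeSlope (ζ := ζ e) (hδ e) hint).symm

lemma MemL1.tendsto_sum_integral_abs_sub_cellAvg (hu : Γ.MemL1 u) :
    Filter.Tendsto (fun n => ∑ e, ∫ t in (0 : ℝ)..Γ.len e, |Γ.onEdge u e t -
      stepFun (Γ.cellLength n e) (cellAvg (Γ.cellLength n e) (Γ.onEdge u e)) t|)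
      Filter.atTop (nhds 0) := by
  simpa only [cellLength, Finset.sum_const_zero] using tendsto_finsetSum Finset.univ fun e _ =>
    tendsto_integral_abs_sub_stepFun_cellAvg (Γ.len_pos e) (hu.intervalIntegrable e)

lemma MemL1.sum_integral_abs_sub_le (hu : Γ.MemL1 u) (n : ℕ) (m : ℝ) :
    ∑ e, ∫ t in (0 : ℝ)..Γ.len e, |Γ.onEdge u e t - m| ≤
      (∑ e, ∫ t in (0 : ℝ)..Γ.len e, |Γ.onEdge u e t -
        stepFun (Γ.cellLength n e) (cellAvg (Γ.cellLength n e) (Γ.onEdge u e)) t|) +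
      ∑ e, ∑ i ∈ Finset.range (n + 1),
        |cellAvg (Γ.cellLength n e) (Γ.onEdge u e) i - m| * Γ.cellLength n e := by
  rw [← Finset.sum_add_distrib]
  refine Finset.sum_le_sum fun e _ => ?_
  have hint : IntervalIntegrable (Γ.onEdge u e) volume 0 ((n + 1 : ℕ) * Γ.cellLength n e) := by
    simpa only [mul_cellLength] using hu.intervalIntegrable e
  simpa only [mul_cellLength] using
    integral_abs_sub_le_add_sum_cellAvg (Γ.cellLength_pos n e) hint m

theorem GridIsoperimetric.mul_le_TV_of_forall_le (hκ : Γ.GridIsoperimetric κ) (hκ0 : 0 ≤ κ)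
    (hu : Γ.MemBV u) {N : ℝ}
    (hN : ∀ m : ℝ, N ≤ ∑ e, ∫ t in (0 : ℝ)..Γ.len e, |Γ.onEdge u e t - m|) :
    ENNReal.ofReal (κ * N) ≤ Γ.TV u := by
  by_cases htop : Γ.TV u = ⊤
  · simp [htop]
  rw [ENNReal.ofReal_le_iff_le_toReal htop]
  have hu_int : Γ.MemL1 u := fun e => (hu e).1
  have herr := (hu_int.tendsto_sum_integral_abs_sub_cellAvg.const_mul κ).add_const (Γ.TV u).toReal
  rw [mul_zero, zero_add] at herr
  refine ge_of_tendsto' herr fun n => ?_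
  obtain ⟨ζ, hζ, m, hm⟩ := hκ.exists_nodalField n fun e =>
    cellAvg (Γ.cellLength n e) (Γ.onEdge u e)
  have hpair := (ENNReal.ofReal_le_iff_le_toReal htop).1 (hu.cellPairing_le_TV hζ)
  have hle := mul_le_mul_of_nonneg_left ((hN m).trans (hu_int.sum_integral_abs_sub_le n m)) hκ0
  rw [mul_add] at hle
  linarith

theorem GridIsoperimetric.mul_l1norm_le_TV (hκ : Γ.GridIsoperimetric κ) (hκ0 : 0 ≤ κ)
    (hu : Γ.MemL1 u) (hm : Γ.IsMedian u m) :
    ENNReal.ofReal κ * Γ.l1norm (fun x => u x - m) ≤ Γ.TV u := by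
  by_cases hBV : Γ.MemBV u
  · rw [hu.l1norm_sub_eq_ofReal, ← ENNReal.ofReal_mul hκ0]
    refine hκ.mul_le_TV_of_forall_le hκ0 hBV fun c => ?_
    have hle := hm.l1norm_le hu c
    rw [hu.l1norm_sub_eq_ofReal, hu.l1norm_sub_eq_ofReal] at hle
    exact (ENNReal.ofReal_le_ofReal_iff (Finset.sum_nonneg fun e _ =>
      intervalIntegral.integral_nonneg (Γ.len_pos e).le fun t _ => abs_nonneg _)).1 hle
  · rw [TV, if_neg hBV]
    exact le_top

end GridIsoperimetry

end CompactMetricGraph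

section JumpSum

open Filter Topology

lemma IsTestFun.setIntegral_indicator_Ici_mul_deriv {a b : ℝ} {φ : ℝ → ℝ} (hφ : IsTestFun a b φ)
    (τ : ℝ) : ∫ t in Ioo a b, (Ici τ).indicator 1 t * deriv φ t = -φ τ := by
  have hsupp (t : ℝ) (ht : t ∉ Ioo a b) : (Ici τ).indicator 1 t * deriv φ t = 0 := by
    rw [image_eq_zero_of_notMem_tsupport fun h => ht (hφ.2.2 (tsupport_deriv_subset h)), mul_zero]
  rw [setIntegral_eq_integral_of_forall_compl_eq_zero hsupp]
  simp only [← indicator_mul_left, Pi.one_apply, one_mul]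
  rw [integral_indicator measurableSet_Ici, integral_Ici_eq_integral_Ioi,
    hφ.2.1.integral_Ioi_deriv_eq (hφ.1.of_le (by simp))]

lemma IsBVOn.congr_ae {a b : ℝ} {f g : ℝ → ℝ} (hf : IsBVOn a b f)
    (h : f =ᵐ[volume.restrict (Ioo a b)] g) : IsBVOn a b g := by
  obtain ⟨hint, p, n, hp, hn, hpn⟩ := hf
  refine ⟨hint.congr h, p, n, hp, hn, fun φ hφ => ?_⟩
  rw [← hpn φ hφ]
  exact integral_congr_ae (h.mono fun t ht => by simp only [ht])

variable {ι : Type*} [Fintype ι]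

/-- The step function with jumps of heights `(p j).1` at the points `(p j).2`. A sequence of step
functions with a bounded number of jumps is a sequence of parameters `p`, to which compactness
applies. -/
noncomputable def jumpSum (p : ι → ℝ × ℝ) (t : ℝ) : ℝ :=
  ∑ j, (p j).1 * (Ici (p j).2).indicator 1 t

lemma measurable_jumpSum (p : ι → ℝ × ℝ) : Measurable (jumpSum p) :=
  Finset.measurable_sum _ fun _ _ => (measurable_one.indicator measurableSet_Ici).const_mul _

lemma abs_jumpSum_le (p : ι → ℝ × ℝ) (t : ℝ) : |jumpSum p t| ≤ ∑ j, |(p j).1| := by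
  refine (Finset.abs_sum_le_sum_abs _ _).trans (Finset.sum_le_sum fun j _ => ?_)
  by_cases h : t ∈ Ici (p j).2 <;> simp [h]

lemma integrableOn_jumpSum_mul (p : ι → ℝ × ℝ) {s : Set ℝ} {g : ℝ → ℝ} (hg : IntegrableOn g s) :
    IntegrableOn (fun t => jumpSum p t * g t) s :=
  hg.bdd_mul (measurable_jumpSum p).aestronglyMeasurable
    (ae_of_all _ fun t => abs_jumpSum_le p t)

lemma IsTestFun.setIntegral_jumpSum_mul_deriv {a b : ℝ} {φ : ℝ → ℝ} (hφ : IsTestFun a b φ)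
    (p : ι → ℝ × ℝ) : ∫ t in Ioo a b, jumpSum p t * deriv φ t = -∑ j, (p j).1 * φ (p j).2 := by
  have hderiv : IntegrableOn (deriv φ) (Ioo a b) :=
    hφ.continuous_deriv.continuousOn.integrableOn_Icc.mono_set Ioo_subset_Icc_self
  simp only [jumpSum, Finset.sum_mul, mul_assoc]
  rw [integral_finsetSum]
  · simp only [integral_const_mul, hφ.setIntegral_indicator_Ici_mul_deriv, mul_neg,
      Finset.sum_neg_distrib]
  · refine fun j _ => Integrable.const_mul ?_ _
    simp only [← indicator_mul_left, Pi.one_apply, one_mul]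
    exact hderiv.indicator measurableSet_Ici

theorem isBVOn_jumpSum (a b : ℝ) (p : ι → ℝ × ℝ) : IsBVOn a b (jumpSum p) := by
  have hfin (c τ : ℝ) := Measure.smul_finite (Measure.dirac τ) (ENNReal.ofReal_ne_top (r := c))
  refine ⟨?_, ∑ j, ENNReal.ofReal (p j).1 • Measure.dirac (p j).2,
    ∑ j, ENNReal.ofReal (-(p j).1) • Measure.dirac (p j).2, inferInstance, inferInstance,
    fun φ hφ => ?_⟩
  · simpa only [mul_one] using integrableOn_jumpSum_mul p (s := Ioo a b) (g := fun _ => 1) (by simp)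
  have hint (c τ : ℝ) : Integrable φ (ENNReal.ofReal c • Measure.dirac τ) :=
    (hφ.1.continuous.integrable_of_hasCompactSupport hφ.2.1).smul_measure ENNReal.ofReal_ne_top
  rw [integral_finsetSum_measure fun j _ => hint _ _,
    integral_finsetSum_measure fun j _ => hint _ _, ← Finset.sum_sub_distrib,
    hφ.setIntegral_jumpSum_mul_deriv]
  refine congrArg _ (Finset.sum_congr rfl fun j _ => ?_)
  simp only [integral_smul_measure, integral_dirac, smul_eq_mul, ← sub_mul,
    ENNReal.toReal_ofReal', max_zero_sub_max_neg_zero_eq_self]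

section Convergence

variable {p : ℕ → ι → ℝ × ℝ} {q : ι → ℝ × ℝ}

lemma tendsto_jumpSum (hp : Tendsto p atTop (𝓝 q)) {t : ℝ} (ht : ∀ j, t ≠ (q j).2) :
    Tendsto (fun k => jumpSum (p k) t) atTop (𝓝 (jumpSum q t)) := by
  refine tendsto_finsetSum _ fun j _ => ?_
  have hj : Tendsto (fun k => p k j) atTop (𝓝 (q j)) := tendsto_pi_nhds.1 hp j
  refine hj.fst_nhds.mul (tendsto_const_nhds.congr' ?_)
  rcases lt_or_gt_of_ne (ht j) with h | h
  · filter_upwards [hj.snd_nhds.eventually_const_lt h] with k hk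
    simp [hk, h]
  · filter_upwards [hj.snd_nhds.eventually_lt_const h] with k hk
    simp [hk.le, h.le]

lemma ae_tendsto_jumpSum (hp : Tendsto p atTop (𝓝 q)) (μ : Measure ℝ) [NullSingletonClass μ] :
    ∀ᵐ t ∂μ, Tendsto (fun k => jumpSum (p k) t) atTop (𝓝 (jumpSum q t)) :=
  (ae_all_iff.2 fun j => Measure.ae_ne μ (q j).2).mono fun _ => tendsto_jumpSum hp

theorem tendsto_integral_jumpSum_mul (hp : Tendsto p atTop (𝓝 q)) {s : Set ℝ} {g : ℝ → ℝ}
    (hg : IntegrableOn g s) : Tendsto (fun k => ∫ t in s, jumpSum (p k) t * g t) atTop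
      (𝓝 (∫ t in s, jumpSum q t * g t)) := by
  have hheights : Tendsto (fun k => ∑ j, |(p k j).1|) atTop (𝓝 (∑ j, |(q j).1|)) :=
    tendsto_finsetSum _ fun j _ => (tendsto_pi_nhds.1 hp j).fst_nhds.abs
  refine tendsto_integral_filter_of_dominated_convergence
    (fun t => (∑ j, |(q j).1| + 1) * ‖g t‖)
    (.of_forall fun k => (integrableOn_jumpSum_mul (p k) hg).aestronglyMeasurable) ?_
    (hg.norm.const_mul _) ((ae_tendsto_jumpSum hp _).mono fun t ht => ht.mul_const _)
  filter_upwards [hheights.eventually_lt_const (lt_add_one _)] with k hk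
  refine ae_of_all _ fun t => ?_
  rw [norm_mul]
  gcongr
  exact (abs_jumpSum_le (p k) t).trans hk.le

end Convergence

section Cells

variable {b : ℕ → ℝ}

/-- The jump of the cell function `b` at the left end of each cell, where `b` is extended by `0` to
the left of the first one. -/
def cellJump (b : ℕ → ℝ) : ℕ → ℝ
  | 0 => b 0
  | k + 1 => b (k + 1) - b k

lemma sum_range_cellJump (b : ℕ → ℝ) (m : ℕ) : ∑ k ∈ Finset.range (m + 1), cellJump b k = b m := by
  rw [Finset.sum_range_succ']
  simp only [cellJump, Finset.sum_range_sub, sub_add_cancel]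

lemma IsZeroOne.cellJump_eq_zero_or (hb : IsZeroOne b) (k : ℕ) :
    cellJump b k = 0 ∨ |cellJump b k| = 1 := by
  cases k with
  | zero => rcases hb 0 with h | h <;> simp [cellJump, h]
  | succ k => rcases hb k with h | h <;> rcases hb (k + 1) with h' | h' <;> simp [cellJump, h, h']

lemma IsZeroOne.cellJump_mem_Icc (hb : IsZeroOne b) (k : ℕ) : cellJump b k ∈ Icc (-1) 1 :=
  abs_le.1 (by rcases hb.cellJump_eq_zero_or k with h | h <;> simp [h])

lemma IsZeroOne.card_cellJump_le (hb : IsZeroOne b) (n : ℕ) :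
    ({k ∈ Finset.range (n + 1) | cellJump b k ≠ 0}.card : ℝ) ≤
      ∑ k ∈ Finset.range n, |b k - b (k + 1)| + 1 := by
  calc ({k ∈ Finset.range (n + 1) | cellJump b k ≠ 0}.card : ℝ)
      = ∑ k ∈ Finset.range (n + 1), |cellJump b k| := by
        rw [Finset.cast_card, Finset.sum_filter]
        refine Finset.sum_congr rfl fun k _ => ?_
        rcases hb.cellJump_eq_zero_or k with h | h
        · simp [h]
        · rw [h, if_pos fun h0 => by simp [h0] at h]
    _ ≤ _ := by
        rw [Finset.sum_range_succ']
        simp only [cellJump, abs_sub_comm (b (_ + 1))]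
        gcongr
        exact abs_le.2 (hb.cellJump_mem_Icc 0)

theorem IsZeroOne.exists_eqOn_jumpSum {l : ℝ} {n M : ℕ} (hb : IsZeroOne b) (hl : 0 < l)
    (hM : ∑ k ∈ Finset.range n, |b k - b (k + 1)| ≤ M) :
    ∃ p : Fin (M + 1) → ℝ × ℝ, (∀ j, p j ∈ Icc (-1) 1 ×ˢ Icc 0 l) ∧
      EqOn (jumpSum p) (stepFun (l / (n + 1 : ℕ)) b) (Ioo 0 l) := by
  have hcard : {k ∈ Finset.range (n + 1) | cellJump b k ≠ 0}.card ≤ M + 1 := by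
    exact_mod_cast (hb.card_cellJump_le n).trans (add_le_add_left hM 1)
  obtain ⟨J, hJ, hJ_card⟩ := Infinite.exists_superset_card_eq _ _ hcard
  let e : Fin (M + 1) ≃ J := (J.equivFinOfCardEq hJ_card).symm
  set δ := l / (n + 1 : ℕ)
  have hδ : 0 < δ := by positivity
  refine ⟨fun j => (cellJump b (e j), min ((e j : ℕ) * δ) l),
    fun j => ⟨hb.cellJump_mem_Icc _, by positivity, min_le_right _ _⟩, fun t ht => ?_⟩
  have hfloor : ⌊t / δ⌋₊ < n + 1 := by
    rw [Nat.floor_lt (div_nonneg ht.1.le hδ.le), div_lt_iff₀ hδ]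
    exact ht.2.trans_eq (by simp only [δ]; field_simp)
  have hmem (k : ℕ) : t ∈ Ici (min (k * δ) l) ↔ k ∈ Finset.range (⌊t / δ⌋₊ + 1) := by
    rw [Finset.mem_range, Nat.lt_succ_iff, Nat.le_floor_iff (div_nonneg ht.1.le hδ.le),
      le_div_iff₀ hδ, mem_Ici, min_le_iff, or_iff_left ht.2.not_ge]
  calc ∑ j, cellJump b (e j) * (Ici (min ((e j : ℕ) * δ) l)).indicator 1 t
      = ∑ k ∈ J, cellJump b k * (Ici (min (k * δ) l)).indicator 1 t := by
        rw [← Finset.sum_coe_sort J]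
        exact e.sum_comp fun k : J => cellJump b k * (Ici (min ((k : ℕ) * δ) l)).indicator 1 t
    _ = ∑ k ∈ J with k ∈ Finset.range (⌊t / δ⌋₊ + 1), cellJump b k := by
        simp only [indicator_apply, hmem, Pi.one_apply, mul_ite, mul_one, mul_zero,
          Finset.sum_filter]
    _ = ∑ k ∈ Finset.range (⌊t / δ⌋₊ + 1), cellJump b k := by
        refine Finset.sum_subset (fun k hk => (Finset.mem_filter.1 hk).2) fun k hk hkJ => ?_
        by_contra hne
        refine hkJ (Finset.mem_filter.2 ⟨hJ (Finset.mem_filter.2 ⟨?_, hne⟩), hk⟩)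
        exact Finset.mem_range.2 ((Finset.mem_range.1 hk).trans_le hfloor)
    _ = stepFun δ b t := sum_range_cellJump b _

end Cells

end JumpSum

namespace CompactMetricGraph

open Filter Topology

variable {V E : Type*} [Fintype V] [Fintype E] (Γ : CompactMetricGraph V E)

section CellIntegral

/-- The integral over `Γ` of the product of `g` with the cell function `b`. -/
noncomputable def cellIntegral (n : ℕ) (b : E → ℕ → ℝ) (g : E → ℝ → ℝ) : ℝ :=
  ∑ e, ∫ t in Ioo 0 (Γ.len e), stepFun (Γ.cellLength n e) (b e) t * g e t

/-- The values of `z` at the nodes of the grid. Nodes beyond the end of an edge, which play no role,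
are moved to the end point. -/
noncomputable def nodeSample (n : ℕ) (z : E → ℝ → ℝ) (e : E) (i : ℕ) : ℝ :=
  z e (min (i * Γ.cellLength n e) (Γ.len e))

lemma node_le {n i : ℕ} (e : E) (hi : i ≤ n + 1) : i * Γ.cellLength n e ≤ Γ.len e := by
  rw [← Γ.mul_cellLength n e]
  have := (Γ.cellLength_pos n e).le
  gcongr

lemma cellIntegral_eq_sum (n : ℕ) (b : E → ℕ → ℝ) {g : E → ℝ → ℝ}
    (hg : ∀ e, IntegrableOn (g e) (Ioo 0 (Γ.len e))) :
    Γ.cellIntegral n b g = ∑ e, ∑ i ∈ Finset.range (n + 1),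
      b e i * ∫ t in (i * Γ.cellLength n e)..((i + 1 : ℕ) * Γ.cellLength n e), g e t := by
  refine Finset.sum_congr rfl fun e _ => ?_
  have hint := (intervalIntegrable_iff_integrableOn_Ioo_of_le (Γ.len_pos e).le).2 (hg e)
  rw [← Γ.mul_cellLength n e] at hint
  rw [setIntegral_Ioo_eq_intervalIntegral (Γ.len_pos e).le,
    ← integral_stepFun_mul (Γ.cellLength_pos n e) hint, mul_cellLength]

lemma cellIntegral_one (n : ℕ) (b : E → ℕ → ℝ) :
    Γ.cellIntegral n b (fun _ _ => 1) = Γ.gridLength n b := by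
  rw [cellIntegral_eq_sum _ _ _ fun e => integrableOn_const (by simp)]
  simp only [intervalIntegral.integral_const, cell_length, smul_eq_mul, mul_one, gridLength]

variable {Γ} {n : ℕ} {b : E → ℕ → ℝ} {z dz : E → ℝ → ℝ}

lemma IsKirchhoffField.integrableOn (hz : Γ.IsKirchhoffField z dz) (e : E) :
    IntegrableOn (dz e) (Ioo 0 (Γ.len e)) :=
  (intervalIntegrable_iff_integrableOn_Ioo_of_le (Γ.len_pos e).le).1
    ((hz.1 e).intervalIntegrable (Γ.len_pos e).le)

lemma IsKirchhoffField.isNodalField_nodeSample (hz : Γ.IsKirchhoffField z dz)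
    (hz_le : Γ.SupNormLeOne z) (n : ℕ) : Γ.IsNodalField n (Γ.nodeSample n z) where
  abs_le_one e i := abs_le_one_of_ae_of_continuousOn (Γ.len_pos e).ne (hz.1 e).1 (hz_le e) _
    ⟨le_min (mul_nonneg (Nat.cast_nonneg _) (Γ.cellLength_pos n e).le) (Γ.len_pos e).le,
      min_le_right _ _⟩
  kirchhoff v := by
    have hfirst (e : E) : Γ.nodeSample n z e 0 = z e 0 := by
      simp [nodeSample, (Γ.len_pos e).le]
    have hlast (e : E) : Γ.nodeSample n z e (n + 1) = z e (Γ.len e) := by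
      rw [nodeSample, mul_cellLength, min_self]
    simpa only [nodeValue, vertexValue, hfirst, hlast] using hz.2 v

lemma IsKirchhoffField.cellIntegral_eq_cellPairing (hz : Γ.IsKirchhoffField z dz) (n : ℕ)
    (b : E → ℕ → ℝ) : Γ.cellIntegral n b dz = cellPairing n b (Γ.nodeSample n z) := by
  rw [cellIntegral_eq_sum _ _ _ hz.integrableOn]
  refine Finset.sum_congr rfl fun e _ => Finset.sum_congr rfl fun i hi => ?_
  have hmem {j : ℕ} (hj : j ≤ n + 1) : j * Γ.cellLength n e ∈ Icc 0 (Γ.len e) :=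
    ⟨mul_nonneg (Nat.cast_nonneg _) (Γ.cellLength_pos n e).le, Γ.node_le e hj⟩
  have hi := Finset.mem_range.1 hi
  rw [(hz.1 e).integral_eq_sub (Γ.len_pos e) (hmem hi.le) (hmem hi), nodeSample, nodeSample,
    min_eq_left (Γ.node_le e hi.le), min_eq_left (Γ.node_le e hi)]

theorem IsKirchhoffField.abs_cellIntegral_le_cut (hz : Γ.IsKirchhoffField z dz)
    (hz_le : Γ.SupNormLeOne z) (hb : ∀ e, IsZeroOne (b e)) :
    |Γ.cellIntegral n b dz| ≤ Γ.cut n b := by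
  rw [hz.cellIntegral_eq_cellPairing]
  exact (hz.isNodalField_nodeSample hz_le n).abs_cellPairing_le_cut hb

end CellIntegral

section GridCheeger

lemma gridLength_add_gridLength_one_sub (n : ℕ) (b : E → ℕ → ℝ) :
    Γ.gridLength n b + Γ.gridLength n (1 - b) = ∑ e, Γ.len e := by
  simp only [gridLength, ← Finset.sum_add_distrib]
  refine Finset.sum_congr rfl fun e _ => ?_
  simp only [Pi.sub_apply, Pi.one_apply, sub_mul, one_mul, add_sub_cancel, Finset.sum_const,
    Finset.card_range, nsmul_eq_mul, mul_cellLength]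

lemma gridMinLength_le (n : ℕ) (b : E → ℕ → ℝ) : Γ.gridMinLength n b ≤ ∑ e, Γ.len e := by
  have hsum := Γ.gridLength_add_gridLength_one_sub n b
  have hlen : 0 ≤ ∑ e, Γ.len e := Finset.sum_nonneg fun e _ => (Γ.len_pos e).le
  rcases le_total 0 (Γ.gridLength n b) with h | h
  · exact (min_le_right _ _).trans (by linarith)
  · exact (min_le_left _ _).trans (h.trans hlen)

/-- The isoperimetric quotients of the `0`-`1` patterns on grids. -/
def gridQuotients : Set ℝ :=
  {r | ∃ (n : ℕ) (b : E → ℕ → ℝ), (∀ e, IsZeroOne (b e)) ∧ 0 < Γ.gridMinLength n b ∧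
    r = Γ.cut n b / Γ.gridMinLength n b}

/-- The Cheeger constant of the sets that are unions of cells of a grid, with the combinatorial
perimeter. -/
noncomputable def gridCheeger : ℝ := sInf Γ.gridQuotients

lemma nonneg_of_mem_gridQuotients {r : ℝ} (hr : r ∈ Γ.gridQuotients) : 0 ≤ r := by
  obtain ⟨n, b, hb, hpos, rfl⟩ := hr
  exact div_nonneg (cut_nonneg hb) hpos.le

lemma bddBelow_gridQuotients : BddBelow Γ.gridQuotients :=
  ⟨0, fun _ => Γ.nonneg_of_mem_gridQuotients⟩

lemma gridCheeger_nonneg : 0 ≤ Γ.gridCheeger :=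
  Real.sInf_nonneg fun _ => Γ.nonneg_of_mem_gridQuotients

lemma gridQuotients_nonempty [Nonempty E] : Γ.gridQuotients.Nonempty := by
  let b : E → ℕ → ℝ := fun _ i => if i = 0 then 1 else 0
  have hb (e : E) : IsZeroOne (b e) := fun i => by
    simp only [b]
    split_ifs <;> simp
  have hlen := Finset.sum_pos (fun e _ => Γ.cellLength_pos 1 e) Finset.univ_nonempty
  have hmin : 0 < Γ.gridMinLength 1 b := by
    simpa [gridMinLength, gridLength, Finset.sum_range_succ, b] using hlen
  exact ⟨_, 1, b, hb, hmin, rfl⟩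

theorem gridIsoperimetric_gridCheeger : Γ.GridIsoperimetric Γ.gridCheeger := by
  intro n b hb
  rcases le_or_gt (Γ.gridMinLength n b) 0 with h | h
  · exact (mul_nonpos_of_nonneg_of_nonpos Γ.gridCheeger_nonneg h).trans (cut_nonneg hb)
  · exact (le_div_iff₀ h).1 (csInf_le Γ.bddBelow_gridQuotients ⟨n, b, hb, h, rfl⟩)

variable {Γ} in
theorem one_le_cut {n : ℕ} {b : E → ℕ → ℝ} (hb : ∀ e, IsZeroOne (b e))
    (hpos : 0 < Γ.gridMinLength n b) : 1 ≤ Γ.cut n b := by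
  by_contra! hlt
  obtain ⟨hlen, hlen'⟩ := lt_min_iff.1 hpos
  rcases isEmpty_or_nonempty E with hE | ⟨⟨e₀⟩⟩
  · simp [gridLength] at hlen
  have hconst (e : E) (i : ℕ) (hi : i ∈ Finset.range (n + 1)) : b e i = b e₀ 0 :=
    eq_of_cut_lt_one hb hlt e e₀ (Finset.mem_range_succ_iff.1 hi) (Nat.zero_le n)
  rcases hb e₀ 0 with h | h
  · refine hlen.ne' (Finset.sum_eq_zero fun e _ => Finset.sum_eq_zero fun i hi => ?_)
    rw [hconst e i hi, h, zero_mul]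
  · refine hlen'.ne' (Finset.sum_eq_zero fun e _ => Finset.sum_eq_zero fun i hi => ?_)
    rw [Pi.sub_apply, Pi.sub_apply, hconst e i hi, h, Pi.one_apply, Pi.one_apply, sub_self,
      zero_mul]

end GridCheeger

section Convergence

lemma exists_measSet_onEdge_ae_eq {f : E → ℝ → ℝ} (hf : ∀ e, Measurable (f e))
    (hf_zeroOne : ∀ e, ∀ᵐ t ∂volume.restrict (Ioo 0 (Γ.len e)), f e t = 0 ∨ f e t = 1) :
    ∃ D : Set Γ.Point, Γ.MeasSet D ∧ ∀ e, f e =ᵐ[volume.restrict (Ioo 0 (Γ.len e))]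
      Γ.onEdge (D.indicator fun _ => 1) e := by
  let D : Set Γ.Point := {x | ∃ e t ht, x = .inner e t ht ∧ f e t = 1}
  have hD (e : E) {t : ℝ} (ht : t ∈ Ioo 0 (Γ.len e)) : Γ.pt e t ∈ D ↔ f e t = 1 := by
    rw [pt, dif_pos ht]
    constructor
    · rintro ⟨e', t', ht', h, hft⟩
      injection h with he ht
      rwa [he, ht]
    · exact fun hft => ⟨e, t, ht, rfl, hft⟩
  refine ⟨D, Γ.measSet_iff.2 fun e => ?_, fun e => ?_⟩
  · refine ((hf e) (measurableSet_singleton 1)).nullMeasurableSet.congr ?_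
    exact (ae_restrict_mem measurableSet_Ioo).mono fun t ht => propext (hD e ht).symm
  · filter_upwards [hf_zeroOne e, ae_restrict_mem measurableSet_Ioo] with t hft ht
    rcases hft with hft | hft
    · rw [onEdge, indicator_of_notMem (by simp [hD e ht, hft]), hft]
    · rw [onEdge, indicator_of_mem ((hD e ht).2 hft), hft]

/-- Weak convergence of the cell functions `b k` to the characteristic function of `D`. -/
def CellTendsto (n : ℕ → ℕ) (b : ℕ → E → ℕ → ℝ) (D : Set Γ.Point) : Prop :=
  ∀ g : E → ℝ → ℝ, (∀ e, IntegrableOn (g e) (Ioo 0 (Γ.len e))) →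
    Tendsto (fun k => Γ.cellIntegral (n k) (b k) g) atTop
      (𝓝 (∑ e, ∫ t in Ioo 0 (Γ.len e), Γ.onEdge (D.indicator fun _ => 1) e t * g e t))

variable {Γ} {D : Set Γ.Point} {n : ℕ → ℕ} {b : ℕ → E → ℕ → ℝ}

lemma MeasSet.length_ne_top (hD : Γ.MeasSet D) : Γ.length D ≠ ⊤ := by
  refine ne_top_of_le_ne_top (b := Γ.length univ) ?_ ?_
  · rw [length_univ]
    exact ENNReal.ofReal_ne_top
  · rw [← hD.length_add_length_compl]
    exact le_self_add

lemma MeasSet.toReal_length (hD : Γ.MeasSet D) : (Γ.length D).toReal =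
    ∑ e, ∫ t in Ioo 0 (Γ.len e), Γ.onEdge (D.indicator fun _ => 1) e t := by
  rw [length_eq, ENNReal.toReal_sum fun e _ => ?_]
  · refine Finset.sum_congr rfl fun e _ => ?_
    change _ = ∫ t in Ioo 0 (Γ.len e), (Γ.pt e ⁻¹' D).indicator (fun _ => 1) t
    rw [integral_indicator₀ (Γ.measSet_iff.1 hD e), setIntegral_const, smul_eq_mul, mul_one,
      measureReal_def, Measure.restrict_apply' measurableSet_Ioo, inter_comm]
  · exact (measure_inter_lt_top_of_left_ne_top (by simp)).ne

lemma CellTendsto.gridLength (h : Γ.CellTendsto n b D) (hD : Γ.MeasSet D) :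
    Tendsto (fun k => Γ.gridLength (n k) (b k)) atTop (𝓝 (Γ.length D).toReal) := by
  simpa only [cellIntegral_one, mul_one, ← hD.toReal_length] using
    h (fun _ _ => 1) fun e => integrableOn_const (by simp)

theorem CellTendsto.gridMinLength (h : Γ.CellTendsto n b D) (hD : Γ.MeasSet D) :
    Tendsto (fun k => Γ.gridMinLength (n k) (b k)) atTop
      (𝓝 (min (Γ.length D) (Γ.length Dᶜ)).toReal) := by
  have hcompl : (Γ.length Dᶜ).toReal = ∑ e, Γ.len e - (Γ.length D).toReal := by
    rw [eq_sub_iff_add_eq', ← ENNReal.toReal_add hD.length_ne_top hD.compl.length_ne_top,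
      hD.length_add_length_compl, length_univ,
      ENNReal.toReal_ofReal (Finset.sum_nonneg fun e _ => (Γ.len_pos e).le)]
  rw [ENNReal.toReal_min hD.length_ne_top hD.compl.length_ne_top, hcompl]
  refine (h.gridLength hD).min (((h.gridLength hD).const_sub _).congr fun k => ?_)
  rw [sub_eq_iff_eq_add', gridLength_add_gridLength_one_sub]

theorem CellTendsto.per_le (h : Γ.CellTendsto n b D) (hb : ∀ k e, IsZeroOne (b k e))
    (hBV : Γ.MemBV (D.indicator fun _ => 1)) {c : ℝ}
    (hc : Tendsto (fun k => Γ.cut (n k) (b k)) atTop (𝓝 c)) : Γ.Per D ≤ ENNReal.ofReal c := by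
  rw [Per, TV, if_pos hBV]
  refine iSup₂_le fun z dz => iSup₂_le fun hz hz_le => ENNReal.ofReal_le_ofReal ?_
  exact le_of_tendsto_of_tendsto' (h dz hz.integrableOn).abs hc fun k =>
    hz.abs_cellIntegral_le_cut hz_le (hb k)

lemma exists_subseq_tendsto_eqOn_jumpSum (hb : ∀ k e, IsZeroOne (b k e)) {C : ℝ}
    (hC : ∀ k, Γ.cut (n k) (b k) ≤ C) :
    ∃ (M : ℕ) (p : ℕ → E → Fin M → ℝ × ℝ) (q : E → Fin M → ℝ × ℝ) (φ : ℕ → ℕ),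
      StrictMono φ ∧ (∀ e, Tendsto (fun k => p k e) atTop (𝓝 (q e))) ∧
      ∀ k e, EqOn (jumpSum (p k e)) (stepFun (Γ.cellLength (n (φ k)) e) (b (φ k) e))
        (Ioo 0 (Γ.len e)) := by
  obtain ⟨M, hM⟩ := exists_nat_ge C
  choose p hp hp_eq using fun k e => (hb k e).exists_eqOn_jumpSum (Γ.len_pos e)
    ((sum_abs_sub_le_cut (hb k) e).trans ((hC k).trans hM))
  have hcompact : IsCompact (univ.pi fun e : E => univ.pi fun _ : Fin (M + 1) =>
      Icc (-1 : ℝ) 1 ×ˢ Icc 0 (Γ.len e)) :=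
    isCompact_univ_pi fun e => isCompact_univ_pi fun _ => isCompact_Icc.prod isCompact_Icc
  obtain ⟨q, -, φ, hφ, hq⟩ := hcompact.tendsto_subseq (x := p) fun k e _ j _ => hp k e j
  exact ⟨M + 1, p ∘ φ, q, φ, hφ, fun e => tendsto_pi_nhds.1 hq e, fun k => hp_eq (φ k)⟩

theorem exists_subseq_cellTendsto (hb : ∀ k e, IsZeroOne (b k e)) {C : ℝ}
    (hC : ∀ k, Γ.cut (n k) (b k) ≤ C) :
    ∃ (D : Set Γ.Point) (φ : ℕ → ℕ), StrictMono φ ∧ Γ.MeasSet D ∧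
      Γ.MemBV (D.indicator fun _ => 1) ∧ Γ.CellTendsto (n ∘ φ) (b ∘ φ) D := by
  obtain ⟨M, p, q, φ, hφ, hp, hp_eq⟩ := exists_subseq_tendsto_eqOn_jumpSum hb hC
  have hq (e : E) : ∀ᵐ t ∂volume.restrict (Ioo 0 (Γ.len e)),
      jumpSum (q e) t = 0 ∨ jumpSum (q e) t = 1 := by
    filter_upwards [ae_tendsto_jumpSum (hp e) _, ae_restrict_mem measurableSet_Ioo] with t ht htm
    refine (toFinite {0, 1}).isClosed.mem_of_tendsto ht (.of_forall fun k => ?_)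
    rw [hp_eq k e htm]
    exact hb (φ k) e _
  obtain ⟨D, hD, hqD⟩ := Γ.exists_measSet_onEdge_ae_eq (fun e => measurable_jumpSum (q e)) hq
  refine ⟨D, φ, hφ, hD, fun e => (isBVOn_jumpSum 0 _ (q e)).congr_ae (hqD e), fun g hg => ?_⟩
  refine tendsto_finsetSum _ fun e _ => ?_
  have hlim : ∫ t in Ioo 0 (Γ.len e), jumpSum (q e) t * g e t =
      ∫ t in Ioo 0 (Γ.len e), Γ.onEdge (D.indicator fun _ => 1) e t * g e t :=
    integral_congr_ae ((hqD e).mul (ae_eq_refl (g e)))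
  refine hlim ▸ (tendsto_integral_jumpSum_mul (hp e) (hg e)).congr fun k => ?_
  refine setIntegral_congr_fun measurableSet_Ioo fun t ht => ?_
  simp only [hp_eq k e ht, Function.comp]

end Convergence

section Cheeger

theorem exists_optimal_set [Nonempty E] : ∃ D : Set Γ.Point, Γ.MeasSet D ∧ 0 < Γ.length D ∧
    Γ.length D < Γ.length univ ∧
    Γ.Per D / min (Γ.length D) (Γ.length Dᶜ) ≤ ENNReal.ofReal Γ.gridCheeger := by
  obtain ⟨r, -, hr, hr_mem⟩ := exists_seq_tendsto_sInf Γ.gridQuotients_nonempty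
    Γ.bddBelow_gridQuotients
  choose n b hb hpos hr_eq using hr_mem
  have hcut (k : ℕ) : r k * Γ.gridMinLength (n k) (b k) = Γ.cut (n k) (b k) := by
    rw [hr_eq, div_mul_cancel₀ _ (hpos k).ne']
  obtain ⟨R, hR⟩ := hr.bddAbove_range
  have hbound (k : ℕ) : Γ.cut (n k) (b k) ≤ R * ∑ e, Γ.len e := by
    have hrR : r k ≤ R := hR (mem_range_self k)
    rw [← hcut]
    exact mul_le_mul hrR (Γ.gridMinLength_le _ _) (hpos k).le
      ((hr_eq k ▸ div_nonneg (cut_nonneg (hb k)) (hpos k).le).trans hrR)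
  obtain ⟨D, φ, hφ, hD, hBV, hlim⟩ := exists_subseq_cellTendsto hb hbound
  set L := min (Γ.length D) (Γ.length Dᶜ)
  have hcut_lim : Tendsto (fun k => Γ.cut (n (φ k)) (b (φ k))) atTop
      (𝓝 (Γ.gridCheeger * L.toReal)) :=
    ((hr.comp hφ.tendsto_atTop).mul (hlim.gridMinLength hD)).congr fun k => hcut (φ k)
  have hone : 1 ≤ Γ.gridCheeger * L.toReal :=
    ge_of_tendsto' hcut_lim fun k => one_le_cut (hb (φ k)) (hpos (φ k))
  have hL : 0 < L := pos_iff_ne_zero.2 fun h => by norm_num [h] at hone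
  obtain ⟨hD_pos, hDc_pos⟩ := lt_min_iff.1 hL
  refine ⟨D, hD, hD_pos, ?_, ENNReal.div_le_of_le_mul ?_⟩
  · rw [← hD.length_add_length_compl]
    exact ENNReal.lt_add_right hD.length_ne_top hDc_pos.ne'
  · refine (hlim.per_le (fun k => hb (φ k)) hBV hcut_lim).trans_eq ?_
    rw [ENNReal.ofReal_mul Γ.gridCheeger_nonneg,
      ENNReal.ofReal_toReal (ne_top_of_le_ne_top hD.length_ne_top (min_le_left _ _))]

variable {Γ} in
theorem MemL1.ofReal_gridCheeger_le_TV_div {u : Γ.Point → ℝ} {m : ℝ} (hu : Γ.MemL1 u)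
    (hu_const : ¬ Γ.AEConst u) (hm : Γ.IsMedian u m) :
    ENNReal.ofReal Γ.gridCheeger ≤ Γ.TV u / Γ.l1norm (fun x => u x - m) := by
  rw [hu.aeConst_iff, not_exists] at hu_const
  rw [ENNReal.le_div_iff_mul_le (.inl (hu_const m))
    (.inl (hu.l1norm_sub_eq_ofReal m ▸ ENNReal.ofReal_ne_top))]
  exact Γ.gridIsoperimetric_gridCheeger.mul_l1norm_le_TV Γ.gridCheeger_nonneg hu hm

theorem cheeger_eq_ofReal_gridCheeger [Nonempty E] :
    Γ.cheeger = ENNReal.ofReal Γ.gridCheeger := by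
  refine le_antisymm ?_ (le_iInf₂ fun D hD => le_iInf₂ fun hD_pos hD_lt => ?_)
  · obtain ⟨D, hD, hD_pos, hD_lt, hquot⟩ := Γ.exists_optimal_set
    exact (iInf₂_le_of_le D hD (iInf₂_le hD_pos hD_lt)).trans hquot
  · obtain ⟨m, hm, hnorm⟩ := hD.exists_isMedian_indicator
    rw [← hnorm]
    exact hD.memL1_indicator.ofReal_gridCheeger_le_TV_div (hD.not_aeConst_indicator hD_pos hD_lt) hm

end Cheeger

end CompactMetricGraph

theorem mainTheorem8 {V E : Type*} [Fintype V] [Fintype E] [Nonempty E]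
    (Γ : CompactMetricGraph V E) :
    IsLeast {r : ℝ≥0∞ | ∃ (u : Γ.Point → ℝ) (μ : ℝ),
        Γ.MemL1 u ∧ ¬ Γ.AEConst u ∧ Γ.IsMedian u μ ∧
          r = Γ.TV u / Γ.l1norm (fun x => u x - μ)} Γ.cheeger ∧
    Γ.cheeger = ⨅ (u : Γ.Point → ℝ) (_ : Γ.MemL1 u) (_ : ¬ Γ.AEConst u),
        ⨆ c : ℝ, Γ.TV u / Γ.l1norm (fun x => u x - c) := by
  obtain ⟨D, hD, hD_pos, hD_lt, hquot⟩ := Γ.exists_optimal_set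
  obtain ⟨m, hm, hnorm⟩ := hD.exists_isMedian_indicator
  have hDL := hD.memL1_indicator
  have hDc := hD.not_aeConst_indicator hD_pos hD_lt
  have hTV : Γ.TV (D.indicator fun _ => 1) / Γ.l1norm (fun x => D.indicator (fun _ => 1) x - m) ≤
      ENNReal.ofReal Γ.gridCheeger := by rwa [hnorm]
  rw [Γ.cheeger_eq_ofReal_gridCheeger]
  refine ⟨⟨⟨_, m, hDL, hDc, hm, (hDL.ofReal_gridCheeger_le_TV_div hDc hm).antisymm hTV⟩, ?_⟩,
    le_antisymm (le_iInf₂ fun u hu => le_iInf fun hc => ?_) ?_⟩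
  · rintro _ ⟨u, μ, hu, hc, hμ, rfl⟩
    exact hu.ofReal_gridCheeger_le_TV_div hc hμ
  · obtain ⟨μ, hμ⟩ := hu.exists_isMedian
    exact le_iSup_of_le μ (hu.ofReal_gridCheeger_le_TV_div hc hμ)
  · refine iInf₂_le_of_le _ hDL (iInf_le_of_le hDc (iSup_le fun c => ?_))
    exact (ENNReal.div_le_div_left (hm.l1norm_le hDL c) _).trans hTV
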